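/- **Notation.** For a set $S\subseteq\mathbb F_2^n$ let $\mathrm{wt}(S)$ be the least Hamming weight of a word of $S$; the minimum distance of a linear code $C\neq 0$ is $d(C)=\mathrm{wt}(C\setminus\{0\})$, and $C^\perp$ is the Euclidean dual. Let $E_n=\{c\in\mathbb F_2^n:\sum_i c_i=0\}$ be the even-weight code $[n,n-1,2]$, and let $H(x)=-x\log_2x-(1-x)\log_2(1-x)$. *Sub-Alternant codes.* Let $\mathbf a=(a_1,\dots,a_n)$ consist of distinct elements of $\mathbb F_{2^m}$. Let $\mathrm{RS}_\delta(\mathbf a)=\{\mathbf y\in\mathbb F_{2^m}^n:\sum_i y_ia_i^j=0,\ 0\le j\le\delta-2\}$ (for $n=2^m-1$ and $a_i=\alpha^{i-1}$ with $\alpha$ primitive this is the usual Reed–Solomon code of designed distance $\delta$). For $\mathbf y\in \mathrm{RS}_\delta(\mathbf a)$ with all entries nonzero, the Sub-Alternant code is $$\mathcal S\text{-}\mathcal A_r(\mathbf a,\mathbf y)=\Big\{c\in\mathbb F_2^n:\ \sum_i c_iy_ia_i^j=0,\ 0\le j\le r-1\Big\}.$$ *Quantum codes.* An $[[n,k,d_z/d_x]]$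 asymmetric quantum code is a subspace $Q$ of $(\mathbb C^2)^{\otimes n}$ of dimension $2^k$ that detects every error consisting of at most $d_x-1$ qubits of $X$-errors and, at the same time, at most $d_z-1$ qubits of $Z$-errors. It is pure if every such error other than the identity maps $Q$ into $Q^\perp$. For linear codes $C_z,C_x\subseteq\mathbb F_2^n$ with $C_x^\perp\subseteq C_z$, the CSS code is the span of the vectors $\sum_{w\in C_z^\perp}|x+w\rangle$, $x\in C_x$. "The CSS construction on $(C_z,C_x)$ gives a pure $[[n,k,d_z/d_x]]$ code" means that $C_x^\perp\subseteq C_z$, $k=\dim C_z+\dim C_x-n$, $d_z=d(C_z)$, $d_x=d(C_x)$, that for $k>0$ also $d_z=\mathrm{wt}(C_z\setminus C_x^\perp)$ and $d_x=\mathrm{wt}(C_x\setminus C_z^\perp)$, and that the CSS code is a pure $[[n,k,d_z/d_x]]$ asymmetric quantum code. **Theorem.** 1. Let $m,n,r,\delta$ be integers with $3\le n\le 2^m+1$ and $1<r<\delta<n$. Then there is a binary linear code $C$ of length $n$ for which the CSS construction on $(C,E_n)$ gives a pure $[[n,k,d_z/2]]$ code with $k\ge n-mr-1$ and $d_z\ge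 r+1$. Moreover, for all $n$-tuples $\mathbf a$ of distinct elements of $\mathbb F_{2^m}$ (which exist for $n\le 2^m$), there is $\mathbf y\in \mathrm{RS}_\delta(\mathbf a)$ without zero entries, and for every such $\mathbf y$ the code $\mathcal S\text{-}\mathcal A_r(\mathbf a,\mathbf y)$ contains the all-ones vector and the CSS construction on $(\mathcal S\text{-}\mathcal A_r(\mathbf a,\mathbf y),E_n)$ gives a pure $[[n,k,d_z/2]]$ code with $k\ge n-mr-1$ and $d_z\ge r+1$. 2. For every real $\delta_z$ with $0<\delta_z<\tfrac12$ there is a sequence of such codes: for every $i$ there are integers $m_i$, $n_i=2^{m_i}-1\ge3$, $r_i,\delta_i$ with $1<r_i<\delta_i<n_i$ and $\delta_i/2<r_i<\min\{\delta_i,n_i/2\}$, a primitive element $\alpha_i$ of $\mathbb F_{2^{m_i}}$, and $\mathbf y_i\in \mathrm{RS}_{\delta_i}(\mathbf a_i)$ without zero entries, where $\mathbf a_i=(1,\alpha_i,\dots,\alpha_i^{n_i-1})$, such that the CSS construction on $(\mathcal S\text{-}\mathcal A_{r_i}(\mathbf a_i,\mathbf y_i),E_{n_i})$ gives a pure $[[n_i,k_i,d_{z,i}/2]]$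 code with $k_i\ge n_i-m_ir_i-1$ and $d_{z,i}\ge r_i+1$, and such that, as $i\to\infty$, $$n_i\to\infty,\qquad \frac{2}{n_i}\to0,\qquad \liminf_{i\to\infty}\frac{d_{z,i}}{n_i}\ge\delta_z,\qquad \frac{k_i}{n_i}\to 1-H(\delta_z).$$ In particular $\limsup_i k_i/n_i=1-H(\delta_z)$: the $Z$-part meets the classical Gilbert–Varshamov bound. -/

import Mathlib

open scoped Matrix
open Filter Topology

namespace QAlternant

/-! ### Binary linear codes -/

/-- The least Hamming weight of a word in a set `S` of binary words. -/
noncomputable def minWeight {n : ℕ} (S : Set (Fin n → ZMod 2)) : ℕ :=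
  sInf ((fun c => hammingNorm c) '' S)

/-- The minimum distance of a (nonzero) binary linear code. -/
noncomputable def minDist {n : ℕ} (C : Submodule (ZMod 2) (Fin n → ZMod 2)) : ℕ :=
  minWeight ((C : Set (Fin n → ZMod 2)) \ {0})

/-- The Euclidean dual of a binary linear code. -/
def dualCode {n : ℕ} (C : Submodule (ZMod 2) (Fin n → ZMod 2)) :
    Submodule (ZMod 2) (Fin n → ZMod 2) where
  carrier := {x | ∀ c ∈ C, c ⬝ᵥ x = 0}
  add_mem' := by
    intro x y hx hy c hc
    rw [dotProduct_add, hx c hc, hy c hc, add_zero]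
  zero_mem' := by
    intro c _
    exact dotProduct_zero c
  smul_mem' := by
    intro t x hx c hc
    rw [dotProduct_smul, hx c hc, smul_zero]

/-- The even-weight code of length `n`: its parity check matrix is the single all-ones row. -/
def evenWeightCode (n : ℕ) : Submodule (ZMod 2) (Fin n → ZMod 2) where
  carrier := {c | ∑ i, c i = 0}
  add_mem' := by
    intro x y hx hy
    simp only [Set.mem_ofPred_eq] at hx hy ⊢
    simp [Finset.sum_add_distrib, hx, hy]
  zero_mem' := by simp
  smul_mem' := by
    intro t x hx
    simp only [Set.mem_ofPred_eq] at hx ⊢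
    simp [← Finset.mul_sum, hx]

/-! ### Reed-Solomon parity checks and Sub-Alternant codes -/

/-- The matrix with `s` rows whose `j`-th row is `(a 0 ^ j, …, a (n - 1) ^ j)`, `0 ≤ j < s`.
With `a i = α ^ i`, `α` a primitive element, and `s = δ - 1` this is the parity check matrix of
the Reed-Solomon code of length `n` and designed distance `δ`. -/
def rsParity {F : Type*} [Field F] {n : ℕ} (a : Fin n → F) (s : ℕ) : Matrix (Fin s) (Fin n) F :=
  Matrix.of fun j i => a i ^ (j : ℕ)

/-- `y` is a codeword of the Reed-Solomon code with locators `a` and designed distance `δ`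
(so `δ - 1` parity checks), and all its entries are nonzero. -/
def IsNowhereZeroRSWord {F : Type*} [Field F] {n : ℕ} (a : Fin n → F) (δ : ℕ) (y : Fin n → F) :
    Prop :=
  rsParity a (δ - 1) *ᵥ y = 0 ∧ ∀ i, y i ≠ 0

/-- The parity check matrix of the Alternant code with `r` parity checks, locators `a` and
multipliers `y`. -/
def alternantParity {F : Type*} [Field F] {n : ℕ} (a y : Fin n → F) (r : ℕ) :
    Matrix (Fin r) (Fin n) F :=
  rsParity a r * Matrix.diagonal y

/-- The binary Alternant code: the binary words in the kernel of `alternantParity a y r`.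
It is called a Sub-Alternant code when `y` satisfies `IsNowhereZeroRSWord a δ y`. -/
def alternantCode {F : Type*} [Field F] [Algebra (ZMod 2) F] {n : ℕ} (a y : Fin n → F) (r : ℕ) :
    Submodule (ZMod 2) (Fin n → ZMod 2) where
  carrier := {c | alternantParity a y r *ᵥ (fun i => algebraMap (ZMod 2) F (c i)) = 0}
  add_mem' := by
    intro c d hc hd
    simp only [Set.mem_ofPred_eq] at hc hd ⊢
    have h : (fun i => algebraMap (ZMod 2) F ((c + d) i)) =
        (fun i => algebraMap (ZMod 2) F (c i)) + fun i => algebraMap (ZMod 2) F (d i) := by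
      funext i
      simp
    rw [h, Matrix.mulVec_add, hc, hd, add_zero]
  zero_mem' := by
    have h : (fun i => algebraMap (ZMod 2) F ((0 : Fin n → ZMod 2) i)) = 0 := by
      funext i
      simp
    rw [Set.mem_ofPred_eq, h, Matrix.mulVec_zero]
  smul_mem' := by
    intro t c hc
    simp only [Set.mem_ofPred_eq] at hc ⊢
    have h : (fun i => algebraMap (ZMod 2) F ((t • c) i)) =
        algebraMap (ZMod 2) F t • fun i => algebraMap (ZMod 2) F (c i) := by
      funext i
      simp
    rw [h, Matrix.mulVec_smul, hc, smul_zero]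

/-! ### Asymmetric quantum codes -/

/-- The state space of `n` qubits, with computational basis indexed by binary words. -/
abbrev QState (n : ℕ) : Type := EuclideanSpace ℂ (Fin n → ZMod 2)

/-- The sign `(-1) ^ t` for `t` in `𝔽₂`. -/
def sgn (t : ZMod 2) : ℂ := if t = 0 then 1 else -1

/-- The Pauli error `X(a) Z(b)`, which maps the basis state `|x⟩` to `(-1) ^ (b ⬝ x) |x + a⟩`. -/
noncomputable def pauli {n : ℕ} (a b : Fin n → ZMod 2) : QState n →ₗ[ℂ] QState n where
  toFun ψ := WithLp.toLp 2 fun x => sgn (b ⬝ᵥ (x - a)) * ψ (x - a)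
  map_add' := by
    intro φ ψ
    ext x
    simp [mul_add]
  map_smul' := by
    intro t ψ
    ext x
    simp [mul_left_comm]

/-- `Q` is an `[[n, k, dz / dx]]` asymmetric quantum code: it has dimension `2 ^ k`, and it detects
(Knill-Laflamme condition) all errors with at most `dx - 1` qubits of `X`-errors and, at the same
time, at most `dz - 1` qubits of `Z`-errors. -/
def IsAQC {n : ℕ} (Q : Submodule ℂ (QState n)) (k dz dx : ℕ) : Prop :=
  Module.finrank ℂ Q = 2 ^ k ∧
    ∀ a b : Fin n → ZMod 2, hammingNorm a < dx → hammingNorm b < dz →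
      ∃ t : ℂ, ∀ u ∈ Q, ∀ v ∈ Q, inner ℂ u (pauli a b v) = t * inner ℂ u v

/-- Purity with respect to `dz / dx`: every nontrivial error in the detectable range maps the code
into its orthogonal complement. -/
def IsPure {n : ℕ} (Q : Submodule ℂ (QState n)) (dz dx : ℕ) : Prop :=
  ∀ a b : Fin n → ZMod 2, hammingNorm a < dx → hammingNorm b < dz → (a ≠ 0 ∨ b ≠ 0) →
    ∀ u ∈ Q, ∀ v ∈ Q, inner ℂ u (pauli a b v) = 0

/-- The CSS code of two binary linear codes `Cz`, `Cx` (with `dualCode Cx ≤ Cz`): it is spanned by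
the coset states `∑ w ∈ dualCode Cz, |x + w⟩`, `x ∈ Cx`. The code `Cz` takes care of the `Z`-errors
and `Cx` of the `X`-errors. -/
noncomputable def cssCode {n : ℕ} (Cz Cx : Submodule (ZMod 2) (Fin n → ZMod 2)) :
    Submodule ℂ (QState n) :=
  Submodule.span ℂ {ψ | ∃ x ∈ Cx,
    ψ = ∑ᶠ w ∈ (dualCode Cz : Set (Fin n → ZMod 2)), EuclideanSpace.single (x + w) (1 : ℂ)}

/-- The CSS construction applies to `Cz`, `Cx` and yields a pure `[[n, k, dz / dx]]` asymmetric
quantum code, where `k = dim Cz + dim Cx - n`, and `dz`, `dx` are the minimum distances of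
`Cz`, `Cx`. For `k > 0` these are also the weights of `Cz \ Cxᗮ` and `Cx \ Czᗮ`; for `k = 0` both
sets are empty, and, as usual for one-dimensional codes, only purity gives the distances meaning. -/
structure IsPureCSS {n : ℕ} (Cz Cx : Submodule (ZMod 2) (Fin n → ZMod 2)) (k dz dx : ℕ) :
    Prop where
  dual_le : dualCode Cx ≤ Cz
  dim_eq : n + k = Module.finrank (ZMod 2) Cz + Module.finrank (ZMod 2) Cx
  dz_eq : dz = minDist Cz
  dx_eq : dx = minDist Cx
  dz_eq_of_pos : 0 < k →
    dz = minWeight ((Cz : Set (Fin n → ZMod 2)) \ (dualCode Cx : Set (Fin n → ZMod 2)))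
  dx_eq_of_pos : 0 < k →
    dx = minWeight ((Cx : Set (Fin n → ZMod 2)) \ (dualCode Cz : Set (Fin n → ZMod 2)))
  isAQC : IsAQC (cssCode Cz Cx) k dz dx
  isPure : IsPure (cssCode Cz Cx) dz dx

/-- The binary entropy function, in bits. -/
noncomputable def binaryEntropy (x : ℝ) : ℝ :=
  -x * Real.logb 2 x - (1 - x) * Real.logb 2 (1 - x)

end QAlternant

open QAlternant

namespace QAlternant

/-! ### Duality of binary codes -/

/-! The dual of `evenWeightCode n` is {0, 1}, so the CSS construction with it needs only that the
all-ones word lies in C. Purity is then formal: a nonzero X-error of weight below 2 lies outside the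
even-weight code, a nonzero Z-error of weight below d(C) lies outside C, and either property sends
the CSS code into its orthogonal complement (`inner_cssCode_pauli`). If y has r vanishing power
sums, these are exactly the parity checks of the alternant code applied to the all-ones word. A
Vandermonde argument gives distance at least r + 1, and counting parity checks over 𝔽₂ gives the
dimension. Lagrange weights supply y. At length 2^m + 1 the locators are the whole projective line.

For the asymptotic part, y is chosen by averaging. Let q = 2^m > n. At least q^(n-r-1) nowhere zero
words y have r vanishing power sums, while a fixed word c with r ≤ wt(c) ≤ n - r imposes r further
independent conditions, leaving at most q^(n-2r) of them. So c lies in the code for a fraction at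
most q^(1-r) of the y. Let l be the target relative distance and H its entropy. Once q^(r-1) exceeds
2·2^(nH), one y both excludes all nonzero words of weight at most ln and keeps the number of
intermediate words below 2^(n(1-H)). Since 1 lies in the code, only 0 and 1 have non-intermediate
weight. This bounds the dimension from above, so the rate tends to 1 - H rather than merely having
lower limit at least 1 - H. -/

theorem dualCode_eq_orthogonal {n : ℕ} (C : Submodule (ZMod 2) (Fin n → ZMod 2)) :
    dualCode C =
      LinearMap.BilinForm.orthogonal (dotProductBilin (ZMod 2) (ZMod 2)) C := by
  ext x
  rfl

theorem dotProductBilin_isRefl (n : ℕ) :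
    (dotProductBilin (ZMod 2) (ZMod 2) :
      LinearMap.BilinForm (ZMod 2) (Fin n → ZMod 2)).IsRefl := by
  intro x y h
  simpa [dotProduct_comm] using h

theorem dotProductBilin_nondegenerate (n : ℕ) :
    (dotProductBilin (ZMod 2) (ZMod 2) :
      LinearMap.BilinForm (ZMod 2) (Fin n → ZMod 2)).Nondegenerate := by
  refine ⟨fun x hx => ?_, fun x hx => ?_⟩
  · exact dotProduct_eq_zero x hx
  · exact dotProduct_eq_zero x fun y => by rw [dotProduct_comm]; exact hx y

theorem finrank_dualCode {n : ℕ} (C : Submodule (ZMod 2) (Fin n → ZMod 2)) :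
    Module.finrank (ZMod 2) (dualCode C) + Module.finrank (ZMod 2) C = n := by
  have h := LinearMap.BilinForm.finrank_orthogonal (dotProductBilin_nondegenerate n) C
  rw [← dualCode_eq_orthogonal, Module.finrank_fin_fun] at h
  have := Submodule.finrank_le C
  rw [Module.finrank_fin_fun] at this
  omega

theorem dualCode_dualCode {n : ℕ} (C : Submodule (ZMod 2) (Fin n → ZMod 2)) :
    dualCode (dualCode C) = C := by
  rw [dualCode_eq_orthogonal, dualCode_eq_orthogonal,
    LinearMap.BilinForm.orthogonal_orthogonal (dotProductBilin_nondegenerate n)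
      (dotProductBilin_isRefl n)]

theorem dualCode_anti {n : ℕ} {C D : Submodule (ZMod 2) (Fin n → ZMod 2)} (h : C ≤ D) :
    dualCode D ≤ dualCode C :=
  fun _ hx c hc => hx c (h hc)

theorem exists_mem_dualCode_dotProduct_eq_one {n : ℕ}
    {C : Submodule (ZMod 2) (Fin n → ZMod 2)} {b : Fin n → ZMod 2} (hb : b ∉ C) :
    ∃ w ∈ dualCode C, b ⬝ᵥ w = 1 := by
  by_contra! h
  refine hb ?_
  rw [← dualCode_dualCode C]
  intro w hw
  rw [dotProduct_comm]
  have := h w hw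
  generalize b ⬝ᵥ w = t at this
  revert t
  decide

theorem sgn_add (s t : ZMod 2) : sgn (s + t) = sgn s * sgn t := by
  have h : ∀ s : ZMod 2, s = 0 ∨ s = 1 := by decide
  have h11 : (1 + 1 : ZMod 2) = 0 := by decide
  rcases h s with rfl | rfl <;> rcases h t with rfl | rfl <;> simp [sgn, h11]

/-! ### Coset states and CSS codes -/

/-- The superposition of the basis states in the coset `x + D`. -/
noncomputable def cosetState {n : ℕ} (D : Submodule (ZMod 2) (Fin n → ZMod 2))
    (x : Fin n → ZMod 2) : QState n :=
  ∑ᶠ w ∈ (D : Set (Fin n → ZMod 2)), EuclideanSpace.single (x + w) (1 : ℂ)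

open Classical in
theorem cosetState_apply {n : ℕ} (D : Submodule (ZMod 2) (Fin n → ZMod 2))
    (x z : Fin n → ZMod 2) : cosetState D x z = if z - x ∈ D then 1 else 0 := by
  rw [cosetState, finsum_mem_eq_finite_toFinset_sum _ (Set.toFinite _), WithLp.ofLp_sum,
    Finset.sum_apply]
  have h : ∀ w, (EuclideanSpace.single (x + w) (1 : ℂ) : QState n) z =
      if w = z - x then 1 else 0 := by
    intro w
    rw [PiLp.single_apply]
    congr 1
    rw [eq_sub_iff_add_eq, add_comm, eq_comm (a := z)]
  simp only [h, Finset.sum_ite_eq', Set.Finite.mem_toFinset, SetLike.mem_coe]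

open Classical in
theorem inner_cosetState_pauli {n : ℕ} (D : Submodule (ZMod 2) (Fin n → ZMod 2))
    (x x' a b : Fin n → ZMod 2) :
    inner ℂ (cosetState D x) (pauli a b (cosetState D x')) =
      ∑ z, (if z - x ∈ D ∧ z - a - x' ∈ D then sgn (b ⬝ᵥ (z - a)) else 0) := by
  rw [PiLp.inner_apply]
  refine Finset.sum_congr rfl fun z _ => ?_
  have h : (pauli a b (cosetState D x')) z = sgn (b ⬝ᵥ (z - a)) * cosetState D x' (z - a) := rfl
  rw [h, cosetState_apply, cosetState_apply]
  by_cases h1 : z - x ∈ D <;> by_cases h2 : z - a - x' ∈ D <;> simp [h1, h2]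

theorem pauli_zero_zero {n : ℕ} : pauli (0 : Fin n → ZMod 2) 0 = LinearMap.id := by
  ext ψ x
  simp [pauli, sgn]

theorem cssCode_eq_span {n : ℕ} (Cz Cx : Submodule (ZMod 2) (Fin n → ZMod 2)) :
    cssCode Cz Cx = Submodule.span ℂ (cosetState (dualCode Cz) '' (Cx : Set (Fin n → ZMod 2))) := by
  unfold cssCode
  congr 1
  ext ψ
  simp only [Set.mem_ofPred_eq, Set.mem_image, SetLike.mem_coe, cosetState, eq_comm]

/-- Coset states are supported in Cx, and an X-part outside Cx moves the support off Cx. If the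
X-part is 0, translation by some w in the dual of Cz with b ⬝ w = 1 preserves the coset and flips
every sign, so the sum equals its own negative. -/
theorem inner_cssCode_pauli {n : ℕ} {Cz Cx : Submodule (ZMod 2) (Fin n → ZMod 2)}
    (hle : dualCode Cz ≤ Cx) {a b : Fin n → ZMod 2} (hab : a ∉ Cx ∨ (a = 0 ∧ b ∉ Cz))
    {u v : QState n} (hu : u ∈ cssCode Cz Cx) (hv : v ∈ cssCode Cz Cx) :
    inner ℂ u (pauli a b v) = 0 := by
  classical
  rw [cssCode_eq_span] at hu hv
  induction hu, hv using Submodule.span_induction₂ with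
  | mem_mem u v hu hv =>
    obtain ⟨x, hx, rfl⟩ := hu
    obtain ⟨x', hx', rfl⟩ := hv
    rw [inner_cosetState_pauli]
    rcases hab with ha | ⟨rfl, hb⟩
    · refine Finset.sum_eq_zero fun z _ => if_neg ?_
      rintro ⟨h1, h2⟩
      refine ha ?_
      have : a = (z - x) - (z - a - x') + x - x' := by abel
      rw [this]
      exact Cx.sub_mem (Cx.add_mem (Cx.sub_mem (hle h1) (hle h2)) hx) hx'
    · obtain ⟨w, hw, hbw⟩ := exists_mem_dualCode_dotProduct_eq_one hb
      rw [← self_eq_neg]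
      conv_lhs => rw [← Equiv.sum_comp (Equiv.addRight w)]
      rw [← Finset.sum_neg_distrib]
      refine Finset.sum_congr rfl fun z _ => ?_
      have e1 : z + w - x = z - x + w := by abel
      have e2 : z - 0 + w - x' = z - 0 - x' + w := by abel
      have e3 : z + w - 0 = z - 0 + w := by abel
      have hs : sgn (b ⬝ᵥ (z - 0 + w)) = -sgn (b ⬝ᵥ (z - 0)) := by
        rw [dotProduct_add, hbw, sgn_add]
        simp [sgn]
      simp only [Equiv.coe_addRight, e1, e2, e3, (dualCode Cz).add_mem_iff_left hw, hs]
      split_ifs <;> simp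
  | zero_left v hv => simp
  | zero_right u hu => simp
  | add_left u u' v _ _ _ h h' => rw [inner_add_left, h, h', add_zero]
  | add_right u v v' _ _ _ h h' => rw [map_add, inner_add_right, h, h', add_zero]
  | smul_left t u v _ _ h => rw [inner_smul_left, h, mul_zero]
  | smul_right t u v _ _ h => rw [map_smul, inner_smul_right, h, mul_zero]

/-- Distinct cosets of the dual of Cz in Cx have disjoint supports, so their states form an
orthogonal basis indexed by the quotient. -/
theorem finrank_cssCode {n k : ℕ} {Cz Cx : Submodule (ZMod 2) (Fin n → ZMod 2)}
    (hle : dualCode Cz ≤ Cx)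
    (hk : n + k = Module.finrank (ZMod 2) Cz + Module.finrank (ZMod 2) Cx) :
    Module.finrank ℂ (cssCode Cz Cx) = 2 ^ k := by
  classical
  set D := dualCode Cz with hD
  let S := D.comap Cx.subtype
  have hS : Module.finrank (ZMod 2) S = Module.finrank (ZMod 2) D :=
    LinearEquiv.finrank_eq (Submodule.comapSubtypeEquivOfLe hle)
  have hq : Module.finrank (ZMod 2) (Cx ⧸ S) = k := by
    have h1 := S.finrank_quotient_add_finrank
    have h2 := finrank_dualCode Cz
    rw [hS] at h1
    rw [← hD] at h2
    omega
  let f : Cx ⧸ S → QState n := fun t => cosetState D (Quotient.out t : Cx)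
  have hmem : ∀ x y : Cx, (Submodule.Quotient.mk x : Cx ⧸ S) = Submodule.Quotient.mk y ↔
      (x : Fin n → ZMod 2) - y ∈ D := fun x y => Submodule.Quotient.eq S
  have hout : ∀ t : Cx ⧸ S, (Submodule.Quotient.mk (Quotient.out t) : Cx ⧸ S) = t :=
    fun t => Quotient.out_eq t
  have hne : ∀ t, f t ≠ 0 := by
    intro t h
    have h' : f t (Quotient.out t : Cx) = 0 := by rw [h]; rfl
    simp only [f, cosetState_apply, sub_self, D.zero_mem, if_true] at h'
    exact one_ne_zero h'
  have horth : Pairwise fun s t => inner ℂ (f s) (f t) = 0 := by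
    intro s t hst
    rw [PiLp.inner_apply]
    refine Finset.sum_eq_zero fun z _ => ?_
    simp only [f, cosetState_apply]
    by_cases h1 : z - ((Quotient.out s : Cx) : Fin n → ZMod 2) ∈ D
    · by_cases h2 : z - ((Quotient.out t : Cx) : Fin n → ZMod 2) ∈ D
      · refine absurd ?_ hst
        rw [← hout s, ← hout t, hmem]
        have := D.sub_mem h2 h1
        rwa [sub_sub_sub_cancel_left] at this
      · simp [h2]
    · simp [h1]
  have hli : LinearIndependent ℂ f := linearIndependent_of_ne_zero_of_inner_eq_zero hne horth
  have hrange : cssCode Cz Cx = Submodule.span ℂ (Set.range f) := by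
    rw [cssCode_eq_span]
    congr 1
    ext ψ
    constructor
    · rintro ⟨x, hx, rfl⟩
      refine ⟨Submodule.Quotient.mk ⟨x, hx⟩, ?_⟩
      have hd := (hmem _ _).1 (hout (Submodule.Quotient.mk ⟨x, hx⟩))
      ext z
      simp only [f, cosetState_apply]
      congr 1
      rw [← D.add_mem_iff_left hd, sub_add_sub_cancel]
    · rintro ⟨t, rfl⟩
      exact ⟨_, (Quotient.out t).2, rfl⟩
  have : Fintype (Cx ⧸ S) := Fintype.ofFinite _
  rw [hrange, finrank_span_eq_card hli, Module.card_eq_pow_finrank (K := ZMod 2), hq, ZMod.card]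

/-! ### Minimum weights -/

theorem minWeight_le {n : ℕ} {S : Set (Fin n → ZMod 2)} {c : Fin n → ZMod 2} (hc : c ∈ S) :
    minWeight S ≤ hammingNorm c :=
  Nat.sInf_le ⟨c, hc, rfl⟩

theorem exists_hammingNorm_eq_minWeight {n : ℕ} {S : Set (Fin n → ZMod 2)} (hS : S.Nonempty) :
    ∃ c ∈ S, hammingNorm c = minWeight S :=
  Nat.sInf_mem (hS.image _)

theorem le_minWeight {n s : ℕ} {S : Set (Fin n → ZMod 2)} (hS : S.Nonempty)
    (h : ∀ c ∈ S, s ≤ hammingNorm c) : s ≤ minWeight S := by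
  obtain ⟨c, hc, hc'⟩ := exists_hammingNorm_eq_minWeight hS
  exact hc' ▸ h c hc

theorem notMem_of_hammingNorm_lt_minDist {n : ℕ} {C : Submodule (ZMod 2) (Fin n → ZMod 2)}
    {c : Fin n → ZMod 2} (h0 : c ≠ 0) (h : hammingNorm c < minDist C) : c ∉ C :=
  fun hc => h.not_ge (minWeight_le ⟨hc, h0⟩)

theorem zmod_two_eq_one_of_ne_zero {t : ZMod 2} (h : t ≠ 0) : t = 1 := by
  revert t
  decide

theorem hammingNorm_one_add {n : ℕ} (c : Fin n → ZMod 2) :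
    hammingNorm c + hammingNorm ((fun _ => 1) + c) = n := by
  have h : ∀ t : ZMod 2, 1 + t ≠ 0 ↔ ¬ t ≠ 0 := by decide
  unfold hammingNorm
  simp only [Pi.add_apply, h]
  rw [Finset.card_filter_add_card_filter_not, Finset.card_univ, Fintype.card_fin]

theorem hammingNorm_const_one (n : ℕ) : hammingNorm (fun _ : Fin n => (1 : ZMod 2)) = n := by
  simp [hammingNorm]

/-! ### CSS codes with the even-weight code -/

theorem mem_evenWeightCode {n : ℕ} {c : Fin n → ZMod 2} :
    c ∈ evenWeightCode n ↔ ∑ i, c i = 0 := Iff.rfl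

theorem evenWeightCode_eq_dualCode (n : ℕ) :
    evenWeightCode n = dualCode (Submodule.span (ZMod 2) {fun _ => 1}) := by
  ext c
  rw [mem_evenWeightCode]
  constructor
  · intro h x hx
    obtain ⟨t, rfl⟩ := Submodule.mem_span_singleton.1 hx
    rw [smul_dotProduct]
    simp [dotProduct, h]
  · intro h
    simpa [dotProduct] using h _ (Submodule.mem_span_singleton_self _)

theorem dualCode_evenWeightCode (n : ℕ) :
    dualCode (evenWeightCode n) = Submodule.span (ZMod 2) {fun _ => 1} := by
  rw [evenWeightCode_eq_dualCode, dualCode_dualCode]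

theorem mem_dualCode_evenWeightCode {n : ℕ} {c : Fin n → ZMod 2} :
    c ∈ dualCode (evenWeightCode n) ↔ c = 0 ∨ c = fun _ => 1 := by
  rw [dualCode_evenWeightCode, Submodule.mem_span_singleton]
  constructor
  · rintro ⟨t, rfl⟩
    by_cases ht : t = 0
    · simp [ht]
    · right
      rw [zmod_two_eq_one_of_ne_zero ht, one_smul]
  · rintro (rfl | rfl)
    · exact ⟨0, zero_smul _ _⟩
    · exact ⟨1, one_smul _ _⟩

theorem finrank_evenWeightCode {n : ℕ} (hn : 0 < n) :
    Module.finrank (ZMod 2) (evenWeightCode n) + 1 = n := by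
  have h := finrank_dualCode (evenWeightCode n)
  rw [dualCode_evenWeightCode, finrank_span_singleton, add_comm] at h
  · exact h
  · intro h0
    exact one_ne_zero (congrFun h0 ⟨0, hn⟩)

theorem single_add_single_mem_evenWeightCode {n : ℕ} (i j : Fin n) :
    (Pi.single i 1 + Pi.single j 1 : Fin n → ZMod 2) ∈ evenWeightCode n := by
  rw [mem_evenWeightCode]
  simp only [Pi.add_apply, Finset.sum_add_distrib, Finset.sum_pi_single', Finset.mem_univ, if_true]
  decide

theorem hammingNorm_single_add_single_le {n : ℕ} (i j : Fin n) :
    hammingNorm (Pi.single i 1 + Pi.single j 1 : Fin n → ZMod 2) ≤ 2 := by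
  refine (Finset.card_le_card ?_).trans (Finset.card_le_two (a := i) (b := j))
  intro l hl
  simp only [Finset.mem_filter, Finset.mem_univ, true_and] at hl
  by_contra h
  simp only [Finset.mem_insert, Finset.mem_singleton, not_or] at h
  exact hl (by simp [h.1, h.2])

theorem two_le_hammingNorm_of_mem_evenWeightCode {n : ℕ} {c : Fin n → ZMod 2}
    (hc : c ∈ evenWeightCode n) (h0 : c ≠ 0) : 2 ≤ hammingNorm c := by
  by_contra! h
  have h1 : hammingNorm c = 1 := by
    have := hammingNorm_pos_iff.2 h0
    omega
  obtain ⟨i, hi⟩ := Finset.card_eq_one.1 h1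
  have hi' : ∀ j, c j ≠ 0 ↔ j = i := by
    intro j
    have := Finset.ext_iff.1 hi j
    simpa using this
  rw [mem_evenWeightCode, Finset.sum_eq_single i] at hc
  · exact (hi' i).2 rfl hc
  · intro j _ hj
    by_contra h
    exact hj ((hi' j).1 h)
  · simp

theorem minDist_evenWeightCode {n : ℕ} (hn : 2 ≤ n) : minDist (evenWeightCode n) = 2 := by
  let i : Fin n := ⟨0, by omega⟩
  let j : Fin n := ⟨1, by omega⟩
  have hij : i ≠ j := by simp [i, j]
  have hmem : (Pi.single i 1 + Pi.single j 1 : Fin n → ZMod 2) ∈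
      ((evenWeightCode n : Set (Fin n → ZMod 2)) \ {0}) := by
    refine ⟨single_add_single_mem_evenWeightCode i j, fun h => ?_⟩
    have := congrFun (Set.mem_singleton_iff.1 h) i
    simp [hij] at this
  refine le_antisymm ((minWeight_le hmem).trans (hammingNorm_single_add_single_le i j)) ?_
  exact le_minWeight ⟨_, hmem⟩ fun c hc =>
    two_le_hammingNorm_of_mem_evenWeightCode hc.1 hc.2

/-- If every word e_i + e_j were orthogonal to C, all words of C would be constant, hence in the
dual of the even-weight code. So some word of weight 2 survives the removal of the dual of C. -/
theorem minWeight_evenWeightCode_diff {n : ℕ} {C : Submodule (ZMod 2) (Fin n → ZMod 2)}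
    (hC : ¬ C ≤ dualCode (evenWeightCode n)) :
    minWeight ((evenWeightCode n : Set (Fin n → ZMod 2)) \ (dualCode C : Set (Fin n → ZMod 2))) =
      2 := by
  obtain ⟨i, j, hij⟩ : ∃ i j : Fin n,
      (Pi.single i 1 + Pi.single j 1 : Fin n → ZMod 2) ∉ dualCode C := by
    by_contra! h
    refine hC fun c hc => ?_
    have hcc : ∀ i j, c i = c j := by
      intro i j
      have := h i j c hc
      rw [dotProduct_add, dotProduct_single_one, dotProduct_single_one] at this
      rwa [CharTwo.add_eq_zero] at this
    intro d hd
    rw [mem_evenWeightCode] at hd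
    rcases isEmpty_or_nonempty (Fin n) with h0 | ⟨⟨i⟩⟩
    · simp [dotProduct]
    · simp only [dotProduct, hcc _ i, ← Finset.sum_mul, hd, zero_mul]
  have hmem : (Pi.single i 1 + Pi.single j 1 : Fin n → ZMod 2) ∈
      ((evenWeightCode n : Set (Fin n → ZMod 2)) \ (dualCode C : Set (Fin n → ZMod 2))) :=
    ⟨single_add_single_mem_evenWeightCode i j, hij⟩
  refine le_antisymm ((minWeight_le hmem).trans (hammingNorm_single_add_single_le i j)) ?_
  refine le_minWeight ⟨_, hmem⟩ fun c hc => two_le_hammingNorm_of_mem_evenWeightCode hc.1 ?_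
  rintro rfl
  exact hc.2 (dualCode C).zero_mem

/-- Only 0 and 1 are removed. Since 1 has the maximal weight n, removing it cannot raise the minimum
while another nonzero word remains. -/
theorem minWeight_diff_dualCode_evenWeightCode {n : ℕ}
    {C : Submodule (ZMod 2) (Fin n → ZMod 2)} (hC : ¬ C ≤ dualCode (evenWeightCode n)) :
    minWeight ((C : Set (Fin n → ZMod 2)) \
      (dualCode (evenWeightCode n) : Set (Fin n → ZMod 2))) = minDist C := by
  obtain ⟨c, hc, hc'⟩ := Set.not_subset.1 hC
  refine le_antisymm ?_ (le_minWeight (Set.nonempty_of_mem (x := c) ⟨hc, hc'⟩) fun e he =>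
    minWeight_le ⟨he.1, ?_⟩)
  · obtain ⟨e, he, hew⟩ : ∃ e ∈ (C : Set (Fin n → ZMod 2)) \ {0}, hammingNorm e = minDist C := by
      refine exists_hammingNorm_eq_minWeight ⟨c, hc, ?_⟩
      rintro rfl
      exact hc' (Submodule.zero_mem _)
    rw [← hew]
    by_cases he1 : e = fun _ => 1
    · subst he1
      rw [hammingNorm_const_one]
      refine (minWeight_le (Set.mem_sdiff_of_mem hc hc')).trans ?_
      have := hammingNorm_one_add c
      omega
    · refine minWeight_le ⟨he.1, fun h => ?_⟩
      rcases mem_dualCode_evenWeightCode.1 h with h | h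
      · exact he.2 h
      · exact he1 h
  · rintro rfl
    exact he.2 (Submodule.zero_mem _)

/-- The CSS construction on a binary code containing the all-ones word and the even-weight code. -/
theorem isPureCSS_evenWeightCode {n k : ℕ} (hn : 2 ≤ n)
    {C : Submodule (ZMod 2) (Fin n → ZMod 2)} (h1 : (fun _ => 1) ∈ C)
    (hk : Module.finrank (ZMod 2) C = k + 1) :
    IsPureCSS C (evenWeightCode n) k (minDist C) 2 := by
  have hle : dualCode (evenWeightCode n) ≤ C := by
    intro c hc
    rcases mem_dualCode_evenWeightCode.1 hc with rfl | rfl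
    exacts [C.zero_mem, h1]
  have hle' : dualCode C ≤ evenWeightCode n := by
    have := dualCode_anti hle
    rwa [dualCode_dualCode] at this
  have hE := finrank_evenWeightCode (n := n) (by omega)
  have hdim : n + k = Module.finrank (ZMod 2) C + Module.finrank (ZMod 2) (evenWeightCode n) := by
    omega
  -- C has dimension k + 1 > 1, whereas {0, 1} has dimension 1.
  have hnot : 0 < k → ¬ C ≤ dualCode (evenWeightCode n) := by
    intro hk0 h
    have h2 := Submodule.finrank_mono h
    have h3 := finrank_dualCode (evenWeightCode n)
    omega
  have hpure : IsPure (cssCode C (evenWeightCode n)) (minDist C) 2 := by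
    intro a b ha hb hab u hu v hv
    refine inner_cssCode_pauli hle' ?_ hu hv
    by_cases ha0 : a = 0
    · exact Or.inr ⟨ha0, notMem_of_hammingNorm_lt_minDist
        (hab.resolve_left (not_not.2 ha0)) hb⟩
    · exact Or.inl (notMem_of_hammingNorm_lt_minDist ha0
        (ha.trans_eq (minDist_evenWeightCode hn).symm))
  refine ⟨hle, hdim, rfl, (minDist_evenWeightCode hn).symm,
    fun hk0 => (minWeight_diff_dualCode_evenWeightCode (hnot hk0)).symm,
    fun hk0 => (minWeight_evenWeightCode_diff (hnot hk0)).symm,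
    ⟨finrank_cssCode hle' hdim, fun a b ha hb => ?_⟩, hpure⟩
  by_cases hab : a ≠ 0 ∨ b ≠ 0
  · exact ⟨0, fun u hu v hv => by rw [hpure a b ha hb hab u hu v hv, zero_mul]⟩
  · push Not at hab
    obtain ⟨rfl, rfl⟩ := hab
    exact ⟨1, fun u _ v _ => by rw [pauli_zero_zero, LinearMap.id_apply, one_mul]⟩

theorem exists_isPureCSS_evenWeightCode {n s r : ℕ} (hn : 2 ≤ n)
    {C : Submodule (ZMod 2) (Fin n → ZMod 2)} (h1 : (fun _ => 1) ∈ C)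
    (hdim : n ≤ Module.finrank (ZMod 2) C + s)
    (hwt : ∀ c ∈ C, c ≠ 0 → r + 1 ≤ hammingNorm c) :
    ∃ k dz : ℕ, IsPureCSS C (evenWeightCode n) k dz 2 ∧ (n : ℤ) - s - 1 ≤ k ∧ r + 1 ≤ dz := by
  have hne : (fun _ => 1 : Fin n → ZMod 2) ≠ 0 := fun h =>
    one_ne_zero (congrFun h ⟨0, by omega⟩)
  have hpos : 0 < Module.finrank (ZMod 2) C :=
    Module.finrank_pos_iff_exists_ne_zero.2 ⟨⟨_, h1⟩, fun h => hne (congrArg Subtype.val h)⟩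
  refine ⟨Module.finrank (ZMod 2) C - 1, minDist C,
    isPureCSS_evenWeightCode hn h1 (by omega), by omega, ?_⟩
  exact le_minWeight ⟨_, h1, hne⟩ fun c hc => hwt c hc.1 hc.2

/-! ### Power sums with few terms -/

section PowerSums

variable {F ι : Type*} [Field F]

theorem sum_mul_eval_eq_zero {a v : ι → F} {T : Finset ι} {r : ℕ}
    (h : ∀ j < r, ∑ i ∈ T, v i * a i ^ j = 0) {p : Polynomial F} (hp : p.natDegree < r) :
    ∑ i ∈ T, v i * p.eval (a i) = 0 := by
  simp only [Polynomial.eval_eq_sum_range, Finset.mul_sum]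
  rw [Finset.sum_comm]
  refine Finset.sum_eq_zero fun j hj => ?_
  have hj' : j < r := by
    have := Finset.mem_range.1 hj
    omega
  rw [← mul_zero (p.coeff j), ← h j hj', Finset.mul_sum]
  exact Finset.sum_congr rfl fun i _ => by ring

/-- Vandermonde independence: the nodal polynomial of T without i has degree below r, so it can be
tested against v, and it isolates the term at i. -/
theorem eq_zero_of_sum_mul_pow_eq_zero {a v : ι → F} {T : Finset ι} {r : ℕ}
    (ha : Set.InjOn a T) (hT : T.card ≤ r) (h : ∀ j < r, ∑ i ∈ T, v i * a i ^ j = 0) :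
    ∀ i ∈ T, v i = 0 := by
  classical
  intro i hi
  have hcard : (T.erase i).card < r :=
    (Finset.card_lt_card (Finset.erase_ssubset hi)).trans_le hT
  have hp : (Lagrange.nodal (T.erase i) a).natDegree < r := by
    rwa [Lagrange.natDegree_nodal]
  have hs := sum_mul_eval_eq_zero h hp
  rw [Finset.sum_eq_single i] at hs
  · refine (mul_eq_zero.1 hs).resolve_right ?_
    refine Lagrange.eval_nodal_not_at_node fun j hj hij => ?_
    obtain ⟨hj1, hj2⟩ := Finset.mem_erase.1 hj
    exact hj1 (ha hj2 hi hij.symm)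
  · intro j hj hji
    rw [Lagrange.eval_nodal_at_node (Finset.mem_erase.2 ⟨hji, hj⟩), mul_zero]
  · exact fun h => absurd hi h

/-- The Lagrange weights are a nowhere zero vector with vanishing power sums. -/
theorem exists_ne_zero_sum_mul_pow_eq_zero [Fintype ι] {a : ι → F} (ha : Function.Injective a) :
    ∃ y : ι → F, (∀ i, y i ≠ 0) ∧ ∀ j, j + 1 < Fintype.card ι → ∑ i, y i * a i ^ j = 0 := by
  classical
  refine ⟨Lagrange.nodalWeight Finset.univ a,
    fun i => Lagrange.nodalWeight_ne_zero ha.injOn (Finset.mem_univ i), fun j hj => ?_⟩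
  -- The power sum is the coefficient of degree card ι - 1 in the interpolant of X^j, which is X^j
  -- itself.
  have h := Lagrange.coeff_eq_sum (s := Finset.univ) (v := a) ha.injOn
    (P := Polynomial.X ^ j) (by
      rw [Polynomial.degree_X_pow, Finset.card_univ]
      exact_mod_cast by omega)
  rw [Polynomial.coeff_X_pow, if_neg (by rw [Finset.card_univ]; omega)] at h
  rw [h]
  refine Finset.sum_congr rfl fun i _ => ?_
  rw [Lagrange.nodalWeight, Finset.prod_inv_distrib, Polynomial.eval_pow, Polynomial.eval_X,
    div_eq_mul_inv, mul_comm]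

end PowerSums

/-! ### Codes given by parity checks -/

section ParityChecks

/-- The binary code whose parity check matrix has the columns `h i`. -/
noncomputable def checkCode {n : ℕ} {V : Type*} [AddCommGroup V] [Module (ZMod 2) V]
    (h : Fin n → V) : Submodule (ZMod 2) (Fin n → ZMod 2) :=
  LinearMap.ker (Fintype.linearCombination (ZMod 2) h)

theorem mem_checkCode {n : ℕ} {V : Type*} [AddCommGroup V] [Module (ZMod 2) V]
    {h : Fin n → V} {c : Fin n → ZMod 2} : c ∈ checkCode h ↔ ∑ i, c i • h i = 0 := Iff.rfl

theorem le_finrank_checkCode {n : ℕ} {V : Type*} [AddCommGroup V] [Module (ZMod 2) V]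
    [Module.Finite (ZMod 2) V] (h : Fin n → V) :
    n ≤ Module.finrank (ZMod 2) (checkCode h) + Module.finrank (ZMod 2) V := by
  have h1 := LinearMap.finrank_range_add_finrank_ker (Fintype.linearCombination (ZMod 2) h)
  have h2 := Submodule.finrank_le (LinearMap.range (Fintype.linearCombination (ZMod 2) h))
  rw [Module.finrank_fin_fun] at h1
  unfold checkCode
  omega

variable {F : Type*} [Field F] {n : ℕ}

theorem rsParity_mulVec_eq_zero {a y : Fin n → F} {s : ℕ} :
    rsParity a s *ᵥ y = 0 ↔ ∀ j < s, ∑ i, y i * a i ^ j = 0 := by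
  rw [funext_iff, Fin.forall_iff]
  simp only [Matrix.mulVec, dotProduct, rsParity, Matrix.of_apply, Pi.zero_apply, mul_comm]

variable [Algebra (ZMod 2) F]

theorem mem_alternantCode {a y : Fin n → F} {r : ℕ} {c : Fin n → ZMod 2} :
    c ∈ alternantCode a y r ↔
      ∀ j < r, ∑ i, algebraMap (ZMod 2) F (c i) * y i * a i ^ j = 0 := by
  change alternantParity a y r *ᵥ (fun i => algebraMap (ZMod 2) F (c i)) = 0 ↔ _
  rw [funext_iff, Fin.forall_iff]
  simp only [alternantParity, Matrix.mulVec, dotProduct, rsParity, Matrix.mul_diagonal,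
    Matrix.of_apply, Pi.zero_apply]
  refine forall₂_congr fun j _ => ?_
  rw [Finset.sum_congr rfl fun i _ => ?_]
  ring

theorem alternantCode_eq_checkCode (a y : Fin n → F) (r : ℕ) :
    alternantCode a y r = checkCode fun i (j : Fin r) => y i * a i ^ (j : ℕ) := by
  ext c
  rw [mem_alternantCode, mem_checkCode, funext_iff, Fin.forall_iff]
  simp only [Finset.sum_apply, Pi.zero_apply]
  refine forall₂_congr fun j _ => ?_
  rw [Finset.sum_congr rfl fun i _ => ?_]
  rw [Pi.smul_apply, Algebra.smul_def, mul_assoc]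

theorem finrank_fin_arrow [Finite F] (r : ℕ) :
    Module.finrank (ZMod 2) (Fin r → F) = Module.finrank (ZMod 2) F * r := by
  rw [Module.finrank_pi_fintype]
  simp [mul_comm]

theorem one_mem_alternantCode {a y : Fin n → F} {r δ : ℕ} (hr : r < δ)
    (hy : IsNowhereZeroRSWord a δ y) : (fun _ => 1) ∈ alternantCode a y r := by
  rw [mem_alternantCode]
  intro j hj
  simpa using rsParity_mulVec_eq_zero.1 hy.1 j (by omega)

theorem lt_hammingNorm_of_mem_alternantCode {a y : Fin n → F} {r : ℕ}
    (ha : Function.Injective a) (hy : ∀ i, y i ≠ 0) {c : Fin n → ZMod 2}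
    (hc : c ∈ alternantCode a y r) (h0 : c ≠ 0) : r + 1 ≤ hammingNorm c := by
  by_contra! hlt
  refine h0 ?_
  rw [mem_alternantCode] at hc
  have h := eq_zero_of_sum_mul_pow_eq_zero (a := a)
    (v := fun i => algebraMap (ZMod 2) F (c i) * y i) (T := Finset.univ.filter fun i => c i ≠ 0)
    (r := r) ha.injOn (Nat.lt_succ_iff.1 hlt) fun j hj => by
      rw [← hc j hj]
      refine Finset.sum_subset (Finset.subset_univ _) fun i _ hi => ?_
      have : c i = 0 := by simpa using hi
      simp [this]
  funext i
  by_contra hi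
  have h' := h i (by simpa using hi)
  rcases mul_eq_zero.1 h' with h' | h'
  · exact hi ((map_eq_zero _).1 h')
  · exact hy i h'

theorem exists_isPureCSS_alternantCode [Finite F] (hn : 2 ≤ n) {a y : Fin n → F} {r δ : ℕ}
    (ha : Function.Injective a) (hr : r < δ) (hy : IsNowhereZeroRSWord a δ y) :
    ∃ k dz : ℕ, IsPureCSS (alternantCode a y r) (evenWeightCode n) k dz 2 ∧
      (n : ℤ) - Module.finrank (ZMod 2) F * r - 1 ≤ k ∧ r + 1 ≤ dz := by
  have h := exists_isPureCSS_evenWeightCode (s := Module.finrank (ZMod 2) F * r) (r := r) hn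
    (one_mem_alternantCode hr hy) ?_
    fun c hc h0 => lt_hammingNorm_of_mem_alternantCode ha hy.2 hc h0
  · exact_mod_cast h
  · rw [alternantCode_eq_checkCode, ← finrank_fin_arrow]
    exact le_finrank_checkCode _

theorem exists_isNowhereZeroRSWord {F : Type*} [Field F] {a : Fin n → F}
    (ha : Function.Injective a) {δ : ℕ} (hδ : δ ≤ n) : ∃ y, IsNowhereZeroRSWord a δ y := by
  obtain ⟨y, hy, hs⟩ := exists_ne_zero_sum_mul_pow_eq_zero ha
  refine ⟨y, rsParity_mulVec_eq_zero.2 fun j hj => hs j ?_, hy⟩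
  rw [Fintype.card_fin]
  omega

end ParityChecks

/-! ### The projective line as set of locators -/

section Projective

variable {F : Type*} [Field F]

/-- The map x ↦ x^s - x takes the value 0 at both 0 and 1, so on a finite field it misses some c. -/
theorem exists_pow_sub_ne [Finite F] {s : ℕ} (hs : s ≠ 0) :
    ∃ c : F, ∀ x : F, x ^ s - x - c ≠ 0 := by
  have hni : ¬ Function.Injective fun x : F => x ^ s - x := fun h =>
    zero_ne_one (h (a₁ := (0 : F)) (a₂ := 1) (by simp [hs]))
  rw [Finite.injective_iff_surjective] at hni
  unfold Function.Surjective at hni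
  push Not at hni
  obtain ⟨c, hc⟩ := hni
  exact ⟨c, fun x => sub_ne_zero.2 (hc x)⟩

/-- A nowhere zero function on `F` whose power sums vanish up to a given exponent, and not
for the next one. -/
theorem exists_ne_zero_sum_mul_pow [Fintype F] {t : ℕ} (ht : t + 3 ≤ Fintype.card F) :
    ∃ y : F → F, (∀ x, y x ≠ 0) ∧ (∀ j < t, ∑ x, y x * x ^ j = 0) ∧ ∑ x, y x * x ^ t ≠ 0 := by
  classical
  -- With s = q - 1 - t, the exponent s + j first reaches q - 1, where the sum over F is nonzero, at
  -- j = t.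
  obtain ⟨s, hs⟩ : ∃ s, Fintype.card F = s + t + 1 := ⟨Fintype.card F - t - 1, by omega⟩
  obtain ⟨c, hc⟩ := exists_pow_sub_ne (F := F) (s := s) (by omega)
  have hexp : ∀ j, ∑ x : F, (x ^ s - x - c) * x ^ j =
      ∑ x : F, x ^ (s + j) - ∑ x : F, x ^ (j + 1) - c * ∑ x : F, x ^ j := by
    intro j
    rw [Finset.mul_sum, ← Finset.sum_sub_distrib, ← Finset.sum_sub_distrib]
    exact Finset.sum_congr rfl fun x _ => by ring
  refine ⟨fun x => x ^ s - x - c, hc, fun j hj => ?_, ?_⟩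
  · rw [hexp, FiniteField.sum_pow_lt_card_sub_one (K := F) (s + j) (by omega),
      FiniteField.sum_pow_lt_card_sub_one (K := F) (j + 1) (by omega),
      FiniteField.sum_pow_lt_card_sub_one (K := F) j (by omega)]
    ring
  · rw [hexp, FiniteField.sum_pow_lt_card_sub_one (K := F) (t + 1) (by omega),
      FiniteField.sum_pow_lt_card_sub_one (K := F) t (by omega), mul_zero, sub_zero, sub_zero]
    have h1 : ∀ x : F, x ^ (s + t) = 1 - if x = 0 then 1 else 0 := by
      intro x
      split_ifs with hx
      · rw [hx, zero_pow (by omega), sub_self]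
      · have := FiniteField.pow_card_sub_one_eq_one x hx
        rw [hs, Nat.add_sub_cancel] at this
        rw [this, sub_zero]
    simp [h1]

variable [Algebra (ZMod 2) F] {n : ℕ}

theorem exists_isPureCSS_projective [Fintype F] (hn : n = Fintype.card F + 1) {r : ℕ}
    (hr : 1 ≤ r) (hr' : r + 2 ≤ Fintype.card F) :
    ∃ (C : Submodule (ZMod 2) (Fin n → ZMod 2)) (k dz : ℕ),
      IsPureCSS C (evenWeightCode n) k dz 2 ∧
        (n : ℤ) - Module.finrank (ZMod 2) F * r - 1 ≤ k ∧ r + 1 ≤ dz := by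
  classical
  obtain ⟨t, rfl⟩ : ∃ t, r = t + 1 := ⟨r - 1, by omega⟩
  obtain ⟨y, hy, hlow, htop⟩ := exists_ne_zero_sum_mul_pow (F := F) (t := t) (by omega)
  let e : Fin n ≃ Option F := Fintype.equivOfCardEq (by simp [hn])
  -- The column at infinity is zero except in the last check, where its entry is chosen so that the
  -- all-ones word satisfies that check.
  let h : Option F → Fin (t + 1) → F := fun o j =>
    o.elim (if (j : ℕ) = t then -∑ x, y x * x ^ t else 0) fun x => y x * x ^ (j : ℕ)
  have hmem : ∀ c : Fin n → ZMod 2, c ∈ checkCode (h ∘ e) ↔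
      ∀ j < t + 1, algebraMap (ZMod 2) F (c (e.symm none)) *
        (if j = t then -∑ x, y x * x ^ t else 0) +
        ∑ x, algebraMap (ZMod 2) F (c (e.symm (some x))) * y x * x ^ j = 0 := by
    intro c
    rw [mem_checkCode, funext_iff, Fin.forall_iff]
    refine forall₂_congr fun j hj => ?_
    rw [← Equiv.sum_comp e.symm, Fintype.sum_option]
    simp [h, Algebra.smul_def, mul_assoc]
  have h1 : (fun _ => 1) ∈ checkCode (h ∘ e) := by
    rw [hmem]
    intro j hj
    rcases Nat.lt_succ_iff_lt_or_eq.1 hj with hj | rfl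
    · simp [hj.ne, hlow j hj]
    · simp
  have hwt : ∀ c ∈ checkCode (h ∘ e), c ≠ 0 → t + 1 + 1 ≤ hammingNorm c := by
    intro c hc h0
    rw [hmem] at hc
    by_contra! hlt
    let T : Finset F := Finset.univ.filter fun x => c (e.symm (some x)) ≠ 0
    have hsum : ∀ j, ∑ x ∈ T, algebraMap (ZMod 2) F (c (e.symm (some x))) * y x * x ^ j =
        ∑ x, algebraMap (ZMod 2) F (c (e.symm (some x))) * y x * x ^ j := by
      intro j
      refine Finset.sum_subset (Finset.subset_univ _) fun x _ hx => ?_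
      have : c (e.symm (some x)) = 0 := by simpa [T] using hx
      simp [this]
    have hcard : hammingNorm c = (if c (e.symm none) ≠ 0 then 1 else 0) + T.card := by
      unfold hammingNorm
      rw [Finset.card_filter, ← Equiv.sum_comp e.symm, Fintype.sum_option, Finset.card_filter]
    have hsupp : ∀ x ∈ T, algebraMap (ZMod 2) F (c (e.symm (some x))) * y x = 0 := by
      by_cases hinf : c (e.symm none) = 0
      · refine eq_zero_of_sum_mul_pow_eq_zero (a := id) (r := t + 1) Function.injective_id.injOn
          (by simp [hinf] at hcard; omega) fun j hj => ?_
        have := hc j hj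
        rw [hinf, map_zero, zero_mul, zero_add] at this
        rw [← this, ← hsum]
        rfl
      -- With infinity in the support, at most t affine positions remain, and the first t checks do
      -- not involve infinity.
      · refine eq_zero_of_sum_mul_pow_eq_zero (a := id) (r := t) Function.injective_id.injOn
          (by simp [hinf] at hcard; omega) fun j hj => ?_
        have := hc j (by omega)
        rw [if_neg hj.ne, mul_zero, zero_add] at this
        rw [← this, ← hsum]
        rfl
    have hzero : ∀ x, c (e.symm (some x)) = 0 := by
      intro x
      by_contra hx
      rcases mul_eq_zero.1 (hsupp x (by simpa [T] using hx)) with h' | h'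
      · exact hx ((map_eq_zero _).1 h')
      · exact hy x h'
    have hinf : c (e.symm none) = 0 := by
      have := hc t (by omega)
      simpa [hzero, htop] using this
    refine h0 (funext fun i => ?_)
    rw [← e.symm_apply_apply i]
    rcases e i with _ | x
    exacts [hinf, hzero x]
  have h := exists_isPureCSS_evenWeightCode (n := n)
    (s := Module.finrank (ZMod 2) F * (t + 1)) (r := t + 1) (by omega) h1
    (by rw [← finrank_fin_arrow]; exact le_finrank_checkCode _) hwt
  exact ⟨_, by exact_mod_cast h⟩

end Projective

theorem exists_isPureCSS_repetition {n s r : ℕ} (hn : 2 ≤ n) (hr : r < n) (hs : n ≤ s + 1) :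
    ∃ (C : Submodule (ZMod 2) (Fin n → ZMod 2)) (k dz : ℕ),
      IsPureCSS C (evenWeightCode n) k dz 2 ∧ (n : ℤ) - s - 1 ≤ k ∧ r + 1 ≤ dz := by
  refine ⟨dualCode (evenWeightCode n), exists_isPureCSS_evenWeightCode hn
    (mem_dualCode_evenWeightCode.2 (Or.inr rfl)) ?_ fun c hc h0 => ?_⟩
  · have := finrank_dualCode (evenWeightCode n)
    have := finrank_evenWeightCode (n := n) (by omega)
    omega
  · rw [(mem_dualCode_evenWeightCode.1 hc).resolve_left h0, hammingNorm_const_one]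
    exact hr

theorem exists_isPureCSS_of_le_two_pow_add_one {m n r : ℕ} (hn : 3 ≤ n) (hnm : n ≤ 2 ^ m + 1)
    (hr : 1 < r) (hrn : r + 1 < n) :
    ∃ (C : Submodule (ZMod 2) (Fin n → ZMod 2)) (k dz : ℕ),
      IsPureCSS C (evenWeightCode n) k dz 2 ∧ (n : ℤ) - m * r - 1 ≤ k ∧ r + 1 ≤ dz := by
  -- Here the dimension bound is vacuous and the repetition code suffices. Otherwise m ≥ 2 and, when
  -- n = 2^m + 1, 2^m > m * r ≥ r + 2, as the projective construction requires.
  by_cases hs : n ≤ m * r + 1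
  · exact_mod_cast exists_isPureCSS_repetition (by omega) (by omega : r < n) hs
  have hm2 : 2 ≤ m := by
    by_contra! h
    interval_cases m <;> omega
  have hm : m ≠ 0 := by omega
  have hcard : Nat.card (GaloisField 2 m) = 2 ^ m := GaloisField.card 2 m hm
  have : Fintype (GaloisField 2 m) := Fintype.ofFinite _
  rw [Nat.card_eq_fintype_card] at hcard
  have hfin : Module.finrank (ZMod 2) (GaloisField 2 m) = m := GaloisField.finrank 2 hm
  rcases hnm.lt_or_eq with h | h
  · obtain ⟨a⟩ : Nonempty (Fin n ↪ GaloisField 2 m) :=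
      Function.Embedding.nonempty_of_card_le (by rw [hcard, Fintype.card_fin]; omega)
    obtain ⟨y, hy⟩ := exists_isNowhereZeroRSWord (δ := r + 1) a.injective (by omega)
    have h := exists_isPureCSS_alternantCode (by omega) a.injective (by omega : r < r + 1) hy
    rw [hfin] at h
    exact ⟨_, h⟩
  · have h := exists_isPureCSS_projective (F := GaloisField 2 m) (n := n) (r := r) (by omega)
      (by omega) (by nlinarith)
    rwa [hfin] at h

/-! ### Counting multipliers -/

section Counting

variable {F : Type*} [Field F] {n : ℕ}

/-- No nonzero word of V is supported in T, so restriction to the complement of T is injective on V.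
-/
theorem finrank_add_card_le {V : Submodule F (Fin n → F)} {T : Finset (Fin n)}
    (h : ∀ v ∈ V, (∀ i ∉ T, v i = 0) → v = 0) : Module.finrank F V + T.card ≤ n := by
  classical
  let f : V →ₗ[F] ({i // i ∉ T} → F) :=
    (LinearMap.funLeft F F (Subtype.val : {i // i ∉ T} → Fin n)).comp V.subtype
  have hf : Function.Injective f := by
    rw [injective_iff_map_eq_zero]
    intro v hv
    exact Subtype.ext (h v v.2 fun i hi => congrFun hv ⟨i, hi⟩)
  have h1 := LinearMap.finrank_le_finrank_of_injective hf
  rw [Module.finrank_fintype_fun_eq_card, Fintype.card_subtype_compl, Fintype.card_fin,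
    Fintype.card_coe] at h1
  have h2 := T.card_le_univ
  rw [Fintype.card_fin] at h2
  omega

/-- The words with `r` vanishing power sums. -/
noncomputable def rsCode (a : Fin n → F) (r : ℕ) : Submodule F (Fin n → F) :=
  LinearMap.ker (rsParity a r).mulVecLin

theorem mem_rsCode {a y : Fin n → F} {r : ℕ} :
    y ∈ rsCode a r ↔ ∀ j < r, ∑ i, y i * a i ^ j = 0 :=
  rsParity_mulVec_eq_zero

theorem le_finrank_rsCode (a : Fin n → F) (r : ℕ) : n ≤ Module.finrank F (rsCode a r) + r := by
  have h1 := LinearMap.finrank_range_add_finrank_ker (rsParity a r).mulVecLin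
  have h2 := Submodule.finrank_le (LinearMap.range (rsParity a r).mulVecLin)
  rw [Module.finrank_fin_fun] at h1 h2
  unfold rsCode
  omega

theorem eq_zero_of_mem_rsCode {a y : Fin n → F} {r : ℕ} (ha : Function.Injective a)
    (hy : y ∈ rsCode a r) {T : Finset (Fin n)} (hT : T.card ≤ r) (h : ∀ i ∉ T, y i = 0) :
    y = 0 := by
  have h0 := eq_zero_of_sum_mul_pow_eq_zero (v := y) ha.injOn hT fun j hj => by
    rw [← mem_rsCode.1 hy j hj]
    exact Finset.sum_subset (Finset.subset_univ _) fun i _ hi => by rw [h i hi, zero_mul]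
  funext i
  by_cases hi : i ∈ T
  exacts [h0 i hi, h i hi]

/-- Vanishing at i is independent of the r checks: the previous criterion applies to i together with
any r other positions. -/
theorem finrank_rsCode_inf_ker_proj_add_le {a : Fin n → F} {r : ℕ} (ha : Function.Injective a)
    (hr : r < n) (i : Fin n) :
    Module.finrank F (rsCode a r ⊓ LinearMap.ker (LinearMap.proj i) : Submodule F (Fin n → F)) +
      (r + 1) ≤ n := by
  obtain ⟨T, hT, hTr⟩ := Finset.exists_subset_card_eq
    (s := Finset.univ.erase i) (n := r) (by simp; omega)
  have hiT : i ∉ T := fun h => Finset.notMem_erase i _ (hT h)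
  rw [← hTr, ← Finset.card_cons hiT]
  refine finrank_add_card_le fun v hv h => ?_
  refine eq_zero_of_mem_rsCode ha hv.1 le_rfl fun l hl => ?_
  by_cases hli : l = i
  · rw [hli]
    exact hv.2
  · exact h l (by simp [hli, hl])

variable [Algebra (ZMod 2) F]

/-- The multipliers `y` for which `c` lies in the alternant code. -/
noncomputable def multiplierSpace (a : Fin n → F) (r : ℕ) (c : Fin n → ZMod 2) :
    Submodule F (Fin n → F) :=
  (rsCode a r).comap (Matrix.diagonal fun i => algebraMap (ZMod 2) F (c i)).mulVecLin

theorem mem_multiplierSpace {a y : Fin n → F} {r : ℕ} {c : Fin n → ZMod 2} :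
    y ∈ multiplierSpace a r c ↔ c ∈ alternantCode a y r := by
  rw [mem_alternantCode, multiplierSpace, Submodule.mem_comap, mem_rsCode]
  simp only [Matrix.mulVecLin_apply, Matrix.mulVec_diagonal]

/-- Take r positions T inside the support of c and r positions U outside it. For v supported on T ∪
U, the product c·v lives on T and must vanish. Then v lives on U and vanishes too, so all 2r
conditions are independent. -/
theorem finrank_rsCode_inf_multiplierSpace_add_le {a : Fin n → F} {r : ℕ}
    (ha : Function.Injective a) {c : Fin n → ZMod 2} (h1 : r ≤ hammingNorm c)
    (h2 : hammingNorm c + r ≤ n) :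
    Module.finrank F (rsCode a r ⊓ multiplierSpace a r c : Submodule F (Fin n → F)) + (r + r) ≤
      n := by
  classical
  obtain ⟨T, hT, hTr⟩ := Finset.exists_subset_card_eq h1
  have hcard : (Finset.univ.filter fun i => ¬ c i ≠ 0).card + hammingNorm c = n := by
    unfold hammingNorm
    rw [add_comm, Finset.card_filter_add_card_filter_not, Finset.card_univ, Fintype.card_fin]
  obtain ⟨U, hU, hUr⟩ := Finset.exists_subset_card_eq
    (s := Finset.univ.filter fun i => ¬ c i ≠ 0) (n := r) (by omega)
  have hTU : Disjoint T U :=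
    (Finset.disjoint_filter_filter_not _ _ _).mono hT hU
  have hcT : ∀ i ∈ T, c i ≠ 0 := fun i hi => (Finset.mem_filter.1 (hT hi)).2
  have hcU : ∀ i ∈ U, c i = 0 := fun i hi => by simpa using (Finset.mem_filter.1 (hU hi)).2
  have hcardTU : (T ∪ U).card = r + r := by
    rw [Finset.card_union_of_disjoint hTU, hTr, hUr]
  rw [← hcardTU]
  refine finrank_add_card_le fun v hv h => ?_
  have hv2 : (Matrix.diagonal fun i => algebraMap (ZMod 2) F (c i)).mulVecLin v = 0 := by
    refine eq_zero_of_mem_rsCode ha hv.2 hTr.le fun i hi => ?_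
    rw [Matrix.mulVecLin_apply, Matrix.mulVec_diagonal]
    by_cases hiU : i ∈ U
    · rw [hcU i hiU, map_zero, zero_mul]
    · rw [h i (by simp [hi, hiU]), mul_zero]
  refine eq_zero_of_mem_rsCode ha hv.1 hUr.le fun i hi => ?_
  by_cases hiT : i ∈ T
  · have := congrFun hv2 i
    rw [Matrix.mulVecLin_apply, Matrix.mulVec_diagonal] at this
    refine (mul_eq_zero.1 this).resolve_left fun h0 => hcT i hiT ((map_eq_zero _).1 h0)
  · exact h i (by simp [hi, hiT])

theorem isNowhereZeroRSWord_succ_iff {F : Type*} [Field F] {a y : Fin n → F} {r : ℕ} :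
    IsNowhereZeroRSWord a (r + 1) y ↔ y ∈ rsCode a r ∧ ∀ i, y i ≠ 0 :=
  Iff.rfl

open Classical in
theorem card_filter_mem_eq_pow_finrank {F : Type*} [Field F] [Fintype F]
    (V : Submodule F (Fin n → F)) :
    (Finset.univ.filter (· ∈ V)).card = Fintype.card F ^ Module.finrank F V := by
  rw [← Module.card_eq_pow_finrank (K := F) (V := V), Fintype.card_subtype]

open Classical in
-- Union bound over the vanishing coordinate: q^(n-r) - n q^(n-r-1) ≥ q^(n-r-1), because q > n.
theorem pow_le_card_isNowhereZeroRSWord {F : Type*} [Field F] [Fintype F] {a : Fin n → F} {r : ℕ}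
    (ha : Function.Injective a) (hr : r < n) (hq : n < Fintype.card F) :
    Fintype.card F ^ (n - r - 1) ≤
      (Finset.univ.filter fun y => IsNowhereZeroRSWord a (r + 1) y).card := by
  set q := Fintype.card F
  let Z : Fin n → Finset (Fin n → F) := fun i =>
    Finset.univ.filter (· ∈ rsCode a r ⊓ LinearMap.ker (LinearMap.proj i))
  have hZ : ∀ i, (Z i).card ≤ q ^ (n - r - 1) := by
    intro i
    rw [card_filter_mem_eq_pow_finrank]
    have := finrank_rsCode_inf_ker_proj_add_le ha hr i
    exact Nat.pow_le_pow_right Fintype.card_pos (by omega)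
  have hR : q ^ (n - r) ≤ (Finset.univ.filter (· ∈ rsCode a r)).card := by
    rw [card_filter_mem_eq_pow_finrank]
    have := le_finrank_rsCode a r
    exact Nat.pow_le_pow_right Fintype.card_pos (by omega)
  have hsub : (Finset.univ.filter (· ∈ rsCode a r)) ⊆
      (Finset.univ.filter fun y => IsNowhereZeroRSWord a (r + 1) y) ∪ Finset.univ.biUnion Z := by
    intro y hy
    simp only [Finset.mem_filter, Finset.mem_univ, true_and] at hy
    by_cases h : ∀ i, y i ≠ 0
    · refine Finset.mem_union_left _ ?_
      simpa using isNowhereZeroRSWord_succ_iff.2 ⟨hy, h⟩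
    · push Not at h
      obtain ⟨i, hi⟩ := h
      refine Finset.mem_union_right _ (Finset.mem_biUnion.2 ⟨i, Finset.mem_univ i, ?_⟩)
      exact Finset.mem_filter.2 ⟨Finset.mem_univ _, hy, hi⟩
  have h1 := (Finset.card_le_card hsub).trans (Finset.card_union_le _ _)
  have h2 : (Finset.univ.biUnion Z).card ≤ n * q ^ (n - r - 1) := by
    have := Finset.card_biUnion_le_card_mul Finset.univ Z _ fun i _ => hZ i
    rwa [Finset.card_univ, Fintype.card_fin] at this
  have h3 : q ^ (n - r) = q * q ^ (n - r - 1) := by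
    rw [← pow_succ']
    congr 1
    omega
  have h4 : (n + 1) * q ^ (n - r - 1) ≤ q * q ^ (n - r - 1) := Nat.mul_le_mul_right _ hq
  rw [add_mul, one_mul] at h4
  omega

open Classical in
/-- A weighted count over all nowhere zero words yields a multiplier for which the words of
intermediate weight in the alternant code have small total weight. -/
theorem exists_isNowhereZeroRSWord_sum_lt_one [Fintype F] {a : Fin n → F} {r : ℕ}
    (ha : Function.Injective a) (hr : r < n) (hr2 : 2 * r ≤ n) (hq : n < Fintype.card F)
    {φ : (Fin n → ZMod 2) → ℝ} (hφ : ∀ c, 0 ≤ φ c)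
    (hsum : (∑ c, φ c) * Fintype.card F < (Fintype.card F : ℝ) ^ r) :
    ∃ y, IsNowhereZeroRSWord a (r + 1) y ∧
      ∑ c with c ∈ alternantCode a y r ∧ r ≤ hammingNorm c ∧ hammingNorm c + r ≤ n, φ c < 1 := by
  by_contra! hcon
  set q := Fintype.card F with hqdef
  set N := Finset.univ.filter fun y => IsNowhereZeroRSWord a (r + 1) y with hN
  have hq0 : (0 : ℝ) < q := by exact_mod_cast Fintype.card_pos
  have h1 : (q : ℝ) ^ (n - r - 1) ≤ N.card := by
    exact_mod_cast pow_le_card_isNowhereZeroRSWord ha hr hq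
  have h2 : (N.card : ℝ) ≤ ∑ y ∈ N, ∑ c with c ∈ alternantCode a y r ∧ r ≤ hammingNorm c ∧
      hammingNorm c + r ≤ n, φ c := by
    rw [Finset.card_eq_sum_ones, Nat.cast_sum, Nat.cast_one]
    exact Finset.sum_le_sum fun y hy => hcon y (Finset.mem_filter.1 hy).2
  -- Double counting: after exchanging the sums, each intermediate c is hit by at most q^(n-2r)
  -- multipliers.
  have h3 : ∑ y ∈ N, ∑ c with c ∈ alternantCode a y r ∧ r ≤ hammingNorm c ∧
      hammingNorm c + r ≤ n, φ c ≤ ∑ c, φ c * (q : ℝ) ^ (n - 2 * r) := by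
    simp only [Finset.sum_filter]
    rw [Finset.sum_comm]
    refine Finset.sum_le_sum fun c _ => ?_
    by_cases hc : r ≤ hammingNorm c ∧ hammingNorm c + r ≤ n
    · rw [← Finset.sum_filter, Finset.sum_const, nsmul_eq_mul, mul_comm]
      refine mul_le_mul_of_nonneg_left ?_ (hφ c)
      have hsub : (N.filter fun y => c ∈ alternantCode a y r ∧ r ≤ hammingNorm c ∧
          hammingNorm c + r ≤ n) ⊆
          Finset.univ.filter (· ∈ rsCode a r ⊓ multiplierSpace a r c) := by
        intro y hy
        obtain ⟨hy1, hy2, -⟩ := Finset.mem_filter.1 hy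
        have hy3 := (isNowhereZeroRSWord_succ_iff.1 (Finset.mem_filter.1 hy1).2).1
        exact Finset.mem_filter.2 ⟨Finset.mem_univ _, hy3, mem_multiplierSpace.2 hy2⟩
      have hcard := Finset.card_le_card hsub
      rw [card_filter_mem_eq_pow_finrank] at hcard
      have hfr := finrank_rsCode_inf_multiplierSpace_add_le ha hc.1 hc.2
      exact_mod_cast hcard.trans (Nat.pow_le_pow_right Fintype.card_pos (by omega))
    · rw [Finset.sum_eq_zero fun y _ => if_neg fun h => hc h.2]
      exact mul_nonneg (hφ c) (by positivity)
  rw [← Finset.sum_mul] at h3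
  have h4 : (q : ℝ) ^ r * (q : ℝ) ^ (n - 2 * r) = q * (q : ℝ) ^ (n - r - 1) := by
    rw [← pow_add, ← pow_succ']
    congr 1
    omega
  have h5 : (0 : ℝ) < (q : ℝ) ^ (n - 2 * r) := by positivity
  have h6 := mul_lt_mul_of_pos_right hsum h5
  rw [h4] at h6
  have h7 := mul_le_mul_of_nonneg_left (h1.trans (h2.trans h3)) hq0.le
  linarith

end Counting

/-! ### The entropy bound -/

theorem binaryEntropy_eq (x : ℝ) : binaryEntropy x = Real.binEntropy x / Real.log 2 := by
  rw [binaryEntropy, Real.binEntropy_eq_negMulLog_add_negMulLog_one_sub, Real.negMulLog,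
    Real.negMulLog, Real.logb, Real.logb]
  ring

theorem binaryEntropy_nonneg {x : ℝ} (h0 : 0 ≤ x) (h1 : x ≤ 1) : 0 ≤ binaryEntropy x := by
  rw [binaryEntropy_eq]
  exact div_nonneg (Real.binEntropy_nonneg h0 h1) (Real.log_nonneg one_le_two)

theorem binaryEntropy_le_one (x : ℝ) : binaryEntropy x ≤ 1 := by
  rw [binaryEntropy_eq, div_le_one (Real.log_pos one_lt_two)]
  exact Real.binEntropy_le_log_two

/-- As l ≤ 1/2, the right side does not increase with w, and at w = ln it would equal the left side.
-/
theorem two_rpow_neg_mul_binaryEntropy_le {n w : ℕ} {l : ℝ} (h0 : 0 < l) (h1 : l ≤ 1 / 2)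
    (hw : (w : ℝ) ≤ l * n) (hwn : w ≤ n) :
    (2 : ℝ) ^ (-(n * binaryEntropy l)) ≤ l ^ w * (1 - l) ^ (n - w) := by
  have hl : 0 < 1 - l := by linarith
  have hlog := Real.log_pos one_lt_two
  have hle : Real.log l ≤ Real.log (1 - l) := Real.log_le_log h0 (by linarith)
  rw [← Real.exp_log (by positivity : 0 < l ^ w * (1 - l) ^ (n - w)),
    Real.rpow_def_of_pos two_pos, Real.exp_le_exp,
    Real.log_mul (by positivity) (by positivity), Real.log_pow, Real.log_pow, Nat.cast_sub hwn,
    binaryEntropy, Real.logb, Real.logb]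
  field_simp
  nlinarith

/-- The expansion of (l + (1 - l))^n over coordinates, that is, the total mass of n independent
Bernoulli bits. -/
theorem sum_pow_hammingNorm_mul (n : ℕ) (l : ℝ) :
    ∑ c : Fin n → ZMod 2, l ^ hammingNorm c * (1 - l) ^ (n - hammingNorm c) = 1 := by
  have h : ∀ c : Fin n → ZMod 2, l ^ hammingNorm c * (1 - l) ^ (n - hammingNorm c) =
      ∏ i, if c i ≠ 0 then l else 1 - l := by
    intro c
    rw [Finset.prod_ite, Finset.prod_const, Finset.prod_const]
    have := Finset.card_filter_add_card_filter_not (s := Finset.univ) fun i => c i ≠ 0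
    rw [Finset.card_univ, Fintype.card_fin] at this
    congr 2
    unfold hammingNorm
    omega
  have h2 : ∑ t : ZMod 2, (if t ≠ 0 then l else 1 - l) = 1 := by
    have : (Finset.univ : Finset (ZMod 2)) = {0, 1} := rfl
    rw [this, Finset.sum_pair zero_ne_one]
    simp
  rw [Finset.sum_congr rfl fun c _ => h c, ← Fintype.piFinset_univ,
    ← Finset.prod_univ_sum (fun _ => Finset.univ) fun _ t => if t ≠ 0 then l else 1 - l,
    Finset.prod_congr rfl fun _ _ => h2, Finset.prod_const_one]

/-- The volume of a Hamming ball of relative radius at most `1 / 2`. -/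
theorem card_hammingNorm_le {n : ℕ} {l : ℝ} (h0 : 0 < l) (h1 : l ≤ 1 / 2) :
    ((Finset.univ.filter fun c : Fin n → ZMod 2 => (hammingNorm c : ℝ) ≤ l * n).card : ℝ) ≤
      2 ^ (n * binaryEntropy l) := by
  have hpos : (0 : ℝ) < 2 ^ (-(n * binaryEntropy l)) := Real.rpow_pos_of_pos two_pos _
  have hl : 0 ≤ 1 - l := by linarith
  have h : ((Finset.univ.filter fun c : Fin n → ZMod 2 => (hammingNorm c : ℝ) ≤ l * n).card : ℝ) *
      2 ^ (-(n * binaryEntropy l)) ≤ 1 := by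
    rw [← sum_pow_hammingNorm_mul n l, ← nsmul_eq_mul, ← Finset.sum_const]
    refine (Finset.sum_le_sum fun c hc => ?_).trans
      (Finset.sum_le_sum_of_subset_of_nonneg (Finset.filter_subset _ _) fun c _ _ => by positivity)
    refine two_rpow_neg_mul_binaryEntropy_le h0 h1 (Finset.mem_filter.1 hc).2 ?_
    simpa using hammingNorm_le_card_fintype (x := c)
  rwa [Real.rpow_neg two_pos.le, ← div_eq_mul_inv,
    div_le_one (Real.rpow_pos_of_pos two_pos _)] at h

/-! ### Alternant codes on the Gilbert–Varshamov bound -/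

theorem exists_alternantCode_minDist_card {F : Type*} [Field F] [Fintype F] [Algebra (ZMod 2) F]
    {n r : ℕ} {a : Fin n → F} (ha : Function.Injective a) (hr2 : 2 * r < n)
    (hq : n < Fintype.card F) {l : ℝ} (h0 : 0 < l) (h1 : l < 1 / 2)
    (hrq : 2 * (2 : ℝ) ^ (n * binaryEntropy l) * Fintype.card F < (Fintype.card F : ℝ) ^ r) :
    ∃ y, IsNowhereZeroRSWord a (r + 1) y ∧
      (∀ c ∈ alternantCode a y r, c ≠ 0 → l * n < hammingNorm c) ∧
      (2 : ℝ) ^ Module.finrank (ZMod 2) (alternantCode a y r) ≤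
        2 + 2 ^ (n * (1 - binaryEntropy l)) := by
  classical
  set H := binaryEntropy l
  set t : ℝ := 2 ^ (n * (1 - H)) with ht
  have ht0 : 0 < t := Real.rpow_pos_of_pos two_pos _
  -- Total weight below 1 excludes low-weight words through the indicator and leaves fewer than t
  -- intermediate words through t⁻¹. Each summand of φ contributes at most 2^(nH) over all words.
  let φ : (Fin n → ZMod 2) → ℝ := fun c =>
    (if (hammingNorm c : ℝ) ≤ l * n then 1 else 0) + t⁻¹
  have hφt : ∀ c, t⁻¹ ≤ φ c := by
    intro c
    simp only [φ]
    split_ifs <;> simp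
  have hφ : ∀ c, 0 ≤ φ c := fun c => (inv_pos.2 ht0).le.trans (hφt c)
  have hsum : ∑ c, φ c ≤ 2 * (2 : ℝ) ^ (n * H) := by
    have hlow := card_hammingNorm_le (n := n) h0 h1.le
    have hall : (2 : ℝ) ^ n * t⁻¹ = 2 ^ (n * H) := by
      rw [ht, ← Real.rpow_natCast, ← Real.rpow_neg two_pos.le, ← Real.rpow_add two_pos]
      congr 1
      ring
    simp only [φ]
    rw [Finset.sum_add_distrib, Finset.sum_const, Finset.card_univ, Fintype.card_fun, ZMod.card,
      Fintype.card_fin, nsmul_eq_mul, Nat.cast_pow, Nat.cast_ofNat, hall, Finset.sum_boole]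
    linarith
  obtain ⟨y, hy, hlt⟩ := exists_isNowhereZeroRSWord_sum_lt_one ha (by omega : r < n) hr2.le hq hφ
    ((mul_le_mul_of_nonneg_right hsum (Nat.cast_nonneg _)).trans_lt hrq)
  have hwt : ∀ c ∈ alternantCode a y r, c ≠ 0 → r + 1 ≤ hammingNorm c :=
    fun c hc hc0 => lt_hammingNorm_of_mem_alternantCode ha hy.2 hc hc0
  refine ⟨y, hy, fun c hc hc0 => ?_, ?_⟩
  · by_contra! hle
    have hn : (hammingNorm c : ℝ) + r ≤ n := by
      have : (2 * r : ℝ) < n := by exact_mod_cast hr2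
      nlinarith
    have hmem : c ∈ Finset.univ.filter fun c => c ∈ alternantCode a y r ∧ r ≤ hammingNorm c ∧
        hammingNorm c + r ≤ n := by
      have := hwt c hc hc0
      simp only [Finset.mem_filter, Finset.mem_univ, true_and]
      exact ⟨hc, by omega, by exact_mod_cast hn⟩
    have h := Finset.single_le_sum (fun c _ => hφ c) hmem
    have hc1 : φ c = 1 + t⁻¹ := by simp only [φ, if_pos hle]
    have := inv_pos.2 ht0
    linarith
  · set S := Finset.univ.filter fun c => c ∈ alternantCode a y r ∧ r ≤ hammingNorm c ∧
        hammingNorm c + r ≤ n with hS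
    have hsub : (Finset.univ.filter (· ∈ alternantCode a y r)) ⊆ {0, fun _ => 1} ∪ S := by
      intro c hc
      have hc := (Finset.mem_filter.1 hc).2
      by_cases hc0 : c = 0
      · simp [hc0]
      by_cases hc1 : (fun _ => 1) + c = 0
      · have : c = fun _ => 1 := by
          funext i
          exact (CharTwo.add_eq_zero.1 (congrFun hc1 i)).symm
        simp [this]
      -- The complement of c is also a nonzero codeword, so its weight exceeds r and c has weight
      -- below n - r.
      · have h2 := hwt c hc hc0
        have h3 := hwt _ ((alternantCode a y r).add_mem
          (one_mem_alternantCode r.lt_succ_self hy) hc) hc1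
        have h4 := hammingNorm_one_add c
        refine Finset.mem_union_right _ (Finset.mem_filter.2 ⟨Finset.mem_univ _, hc, ?_, ?_⟩) <;>
          omega
    have hcard := ((Finset.card_le_card hsub).trans (Finset.card_union_le _ _)).trans
      (Nat.add_le_add_right Finset.card_le_two _)
    rw [card_filter_mem_eq_pow_finrank, ZMod.card] at hcard
    have hSt : S.card * t⁻¹ < 1 := by
      rw [← nsmul_eq_mul, ← Finset.sum_const]
      exact (Finset.sum_le_sum fun c _ => hφt c).trans_lt hlt
    rw [← div_eq_mul_inv, div_lt_one ht0] at hSt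
    have hcard' : (2 : ℝ) ^ Module.finrank (ZMod 2) (alternantCode a y r) ≤ 2 + S.card := by
      exact_mod_cast hcard
    linarith

theorem exists_isPrimitiveRoot_galoisField {m : ℕ} (hm : m ≠ 0) :
    ∃ α : GaloisField 2 m, IsPrimitiveRoot α (2 ^ m - 1) := by
  have : Fintype (GaloisField 2 m) := Fintype.ofFinite _
  obtain ⟨g, hg⟩ := IsCyclic.exists_generator (α := (GaloisField 2 m)ˣ)
  refine ⟨g, ?_⟩
  have h : orderOf (g : GaloisField 2 m) = 2 ^ m - 1 := by
    rw [orderOf_units, orderOf_eq_card_of_forall_mem_zpowers hg, Nat.card_units,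
      GaloisField.card 2 m hm]
  rw [← h]
  exact IsPrimitiveRoot.orderOf _

/-- A primitive Sub-Alternant code of length `2 ^ m - 1` that is close to the Gilbert–Varshamov
bound, with a dimension that is not too large either. -/
theorem exists_isPureCSS_gilbertVarshamov {m : ℕ} (hm : 8 ≤ m) {l : ℝ} (h0 : 0 < l)
    (h1 : l < 1 / 2) :
    ∃ (r k dz : ℕ) (α : GaloisField 2 m) (y : Fin (2 ^ m - 1) → GaloisField 2 m),
      1 < r ∧ 2 * r < 2 ^ m - 1 ∧ IsPrimitiveRoot α (2 ^ m - 1) ∧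
      IsNowhereZeroRSWord (fun j : Fin (2 ^ m - 1) => α ^ (j : ℕ)) (r + 1) y ∧
      IsPureCSS (alternantCode (fun j : Fin (2 ^ m - 1) => α ^ (j : ℕ)) y r)
        (evenWeightCode (2 ^ m - 1)) k dz 2 ∧
      ((2 ^ m - 1 : ℕ) : ℤ) - m * r - 1 ≤ k ∧ r + 1 ≤ dz ∧
      l * (2 ^ m - 1 : ℕ) ≤ dz ∧ dz ≤ 2 ^ m - 1 ∧
      |(k : ℝ) - (2 ^ m - 1 : ℕ) * (1 - binaryEntropy l)| ≤ 3 * m := by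
  have hm0 : m ≠ 0 := by omega
  have : Fintype (GaloisField 2 m) := Fintype.ofFinite _
  have hcard : Fintype.card (GaloisField 2 m) = 2 ^ m := by
    rw [← Nat.card_eq_fintype_card, GaloisField.card 2 m hm0]
  obtain ⟨α, hα⟩ := exists_isPrimitiveRoot_galoisField hm0
  obtain ⟨n, hn⟩ : ∃ n, n = 2 ^ m - 1 := ⟨_, rfl⟩
  have hmn : m < 2 ^ m := Nat.lt_two_pow_self
  rw [← hn] at hα ⊢
  set H := binaryEntropy l with hH
  have hH0 : 0 ≤ H := binaryEntropy_nonneg h0.le (by linarith)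
  have hH1 : H ≤ 1 := binaryEntropy_le_one l
  have hm8 : (8 : ℝ) ≤ m := by exact_mod_cast hm
  have hnm : (m : ℝ) ≤ n := by exact_mod_cast (by omega : m ≤ n)
  have hmpos : (0 : ℝ) < m := by linarith
  have hnH : 0 ≤ n * H := mul_nonneg (Nat.cast_nonneg _) hH0
  have hnH1 : n * H ≤ n := mul_le_of_le_one_right (Nat.cast_nonneg _) hH1
  -- The least r with m r > nH + m + 1, which is 2·2^(nH)·q < q^r in exponents. The overshoot is at
  -- most m, so the redundancy stays within O(m) of nH.
  obtain ⟨r, hr⟩ : ∃ r, r = ⌊(n * H + m + 1) / m⌋₊ + 1 := ⟨_, rfl⟩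
  have hx0 : 0 ≤ (n * H + m + 1) / m := by positivity
  have hrl : n * H + m + 1 < m * r := by
    have := Nat.lt_floor_add_one ((n * H + m + 1) / m)
    rw [div_lt_iff₀ hmpos] at this
    rw [hr]
    push_cast
    linarith
  have hru : m * r ≤ n * H + 2 * m + 1 := by
    have := Nat.floor_le hx0
    rw [le_div_iff₀ hmpos] at this
    rw [hr]
    push_cast
    linarith
  have hr1 : 1 < r := by
    by_contra! h
    have : (r : ℝ) ≤ 1 := by exact_mod_cast h
    nlinarith
  have hr2 : 2 * r < n := by
    have : (2 * r : ℝ) < n := by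
      by_contra! h
      nlinarith
    exact_mod_cast this
  have hinj : Function.Injective fun j : Fin n => α ^ (j : ℕ) := fun i j hij =>
    Fin.ext (hα.pow_inj i.2 j.2 hij)
  have hrq : 2 * (2 : ℝ) ^ (n * H) * Fintype.card (GaloisField 2 m) <
      (Fintype.card (GaloisField 2 m) : ℝ) ^ r := by
    rw [hcard, Nat.cast_pow, Nat.cast_ofNat, ← pow_mul, ← Real.rpow_natCast, ← Real.rpow_natCast]
    nth_rewrite 1 [← Real.rpow_one 2]
    rw [← Real.rpow_add two_pos, ← Real.rpow_add two_pos]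
    refine Real.rpow_lt_rpow_of_exponent_lt one_lt_two ?_
    push_cast
    linarith
  obtain ⟨y, hy, hd, hk⟩ := exists_alternantCode_minDist_card hinj hr2 (by omega) h0 h1 hrq
  obtain ⟨k, dz, hcss, hk1, hdz⟩ :=
    exists_isPureCSS_alternantCode (by omega) hinj r.lt_succ_self hy
  rw [GaloisField.finrank 2 hm0] at hk1
  have h1mem := one_mem_alternantCode r.lt_succ_self hy
  have h1ne : (fun _ => 1 : Fin n → ZMod 2) ≠ 0 := fun h =>
    one_ne_zero (congrFun h ⟨0, by omega⟩)
  have hmem : (fun _ => 1) ∈ ((alternantCode (fun j : Fin n => α ^ (j : ℕ)) y r :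
      Set (Fin n → ZMod 2)) \ {0}) := ⟨h1mem, h1ne⟩
  have hdzl : l * n ≤ dz := by
    obtain ⟨c, hc, hcw⟩ := exists_hammingNorm_eq_minWeight
      (Set.nonempty_of_mem hmem)
    have h := hd c hc.1 hc.2
    rw [hcw] at h
    rw [hcss.dz_eq]
    exact h.le
  have hdzu : dz ≤ n := by
    rw [hcss.dz_eq]
    exact (minWeight_le hmem).trans (hammingNorm_const_one n).le
  refine ⟨r, k, dz, α, y, hr1, hr2, hα, hy, hcss, hk1, hdz, hdzl, hdzu, ?_⟩
  have hk1' : (n : ℝ) - m * r - 1 ≤ k := by exact_mod_cast hk1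
  have hfin : Module.finrank (ZMod 2) (alternantCode (fun j : Fin n => α ^ (j : ℕ)) y r) =
      k + 1 := by
    have := hcss.dim_eq
    have := finrank_evenWeightCode (n := n) (by omega)
    omega
  have hku : (k : ℝ) ≤ n * (1 - H) + 1 := by
    have hone : (1 : ℝ) ≤ 2 ^ (n * (1 - H)) :=
      Real.one_le_rpow one_le_two (by nlinarith)
    -- As 2^(n(1-H)) ≥ 1, the additive 2 for the words 0 and 1 is absorbed in a factor 4.
    have h2 : (2 : ℝ) ^ ((k : ℝ) + 1) ≤ 2 ^ (n * (1 - H) + 2) := by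
      rw [hfin, ← Real.rpow_natCast] at hk
      push_cast at hk
      rw [Real.rpow_add two_pos (n * (1 - H)), Real.rpow_two]
      linarith
    have := (Real.rpow_le_rpow_left_iff one_lt_two).1 h2
    linarith
  rw [abs_le]
  constructor <;> linarith

/-- It gives n ≥ m², so the error 3m in the dimension costs at most 3/m in the rate. -/
theorem sq_lt_two_pow_add_eight (i : ℕ) : (i + 8) ^ 2 < 2 ^ (i + 8) := by
  induction i with
  | zero => norm_num
  | succ i ih =>
    have : 2 ^ (i + 1 + 8) = 2 * 2 ^ (i + 8) := by ring
    have : (i + 1 + 8) ^ 2 ≤ 2 * (i + 8) ^ 2 := by nlinarith [Nat.zero_le i, Nat.zero_le (i ^ 2)]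
    omega

end QAlternant

theorem theorem3p3 :
    (∀ m n r δ : ℕ, 3 ≤ n → n ≤ 2 ^ m + 1 → 1 < r → r < δ → δ < n →
      -- existence in the whole range of lengths
      (∃ (C : Submodule (ZMod 2) (Fin n → ZMod 2)) (k dz : ℕ),
        IsPureCSS C (evenWeightCode n) k dz 2 ∧
        (n : ℤ) - m * r - 1 ≤ k ∧ r + 1 ≤ dz) ∧
      -- the construction from Sub-Alternant codes
      (∀ a : Fin n → GaloisField 2 m, Function.Injective a →
        (∃ y, IsNowhereZeroRSWord a δ y) ∧
        ∀ y, IsNowhereZeroRSWord a δ y →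
          (fun _ => 1) ∈ alternantCode a y r ∧
          ∃ k dz : ℕ, IsPureCSS (alternantCode a y r) (evenWeightCode n) k dz 2 ∧
            (n : ℤ) - m * r - 1 ≤ k ∧ r + 1 ≤ dz)) ∧
    -- asymptotically good families of primitive Sub-Alternant codes
    (∀ δz : ℝ, 0 < δz → δz < 1 / 2 →
      ∃ (m n r δ k dz : ℕ → ℕ) (α : ∀ i, GaloisField 2 (m i))
        (y : ∀ i, Fin (n i) → GaloisField 2 (m i)),
        (∀ i, n i = 2 ^ m i - 1 ∧ 3 ≤ n i ∧ 1 < r i ∧ r i < δ i ∧ δ i < n i ∧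
          δ i < 2 * r i ∧ 2 * r i < n i ∧
          IsPrimitiveRoot (α i) (2 ^ m i - 1) ∧
          IsNowhereZeroRSWord (fun j : Fin (n i) => α i ^ (j : ℕ)) (δ i) (y i) ∧
          IsPureCSS (alternantCode (fun j : Fin (n i) => α i ^ (j : ℕ)) (y i) (r i))
            (evenWeightCode (n i)) (k i) (dz i) 2 ∧
          (n i : ℤ) - m i * r i - 1 ≤ k i ∧ r i + 1 ≤ dz i) ∧
        Tendsto n atTop atTop ∧
        Tendsto (fun i => (2 : ℝ) / n i) atTop (𝓝 0) ∧
        δz ≤ liminf (fun i => (dz i : ℝ) / n i) atTop ∧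
        Tendsto (fun i => (k i : ℝ) / n i) atTop (𝓝 (1 - binaryEntropy δz)) ∧
        limsup (fun i => (k i : ℝ) / n i) atTop = 1 - binaryEntropy δz) := by
  refine ⟨fun m n r δ hn hnm hr hrδ hδn =>
    ⟨exists_isPureCSS_of_le_two_pow_add_one hn hnm hr (by omega), fun a ha =>
      ⟨exists_isNowhereZeroRSWord ha hδn.le, fun y hy => ⟨one_mem_alternantCode hrδ hy, ?_⟩⟩⟩,
    fun δz h0 h1 => ?_⟩
  · have hm : m ≠ 0 := by
      rintro rfl
      omega
    have h := exists_isPureCSS_alternantCode (by omega) ha hrδ hy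
    rwa [GaloisField.finrank 2 hm] at h
  have hm8 : ∀ i : ℕ, 8 ≤ i + 8 := fun i => by omega
  choose r k dz α y hr hr2 hα hy hcss hk hdz hdl hdu hka using
    fun i : ℕ => exists_isPureCSS_gilbertVarshamov (hm8 i) h0 h1
  have hsq : ∀ i, (i + 8) ^ 2 ≤ 2 ^ (i + 8) - 1 := fun i => by
    have := sq_lt_two_pow_add_eight i
    omega
  have hlow : ∀ i : ℕ, i ≤ 2 ^ (i + 8) - 1 := fun i => by
    have := hsq i
    nlinarith
  have hn : Tendsto (fun i => 2 ^ (i + 8) - 1) atTop atTop := tendsto_atTop_mono hlow tendsto_id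
  have hnpos : ∀ i, (0 : ℝ) < (2 ^ (i + 8) - 1 : ℕ) := fun i => by
    have := hr2 i
    exact_mod_cast (by omega : 0 < 2 ^ (i + 8) - 1)
  have hrate : Tendsto (fun i => (k i : ℝ) / (2 ^ (i + 8) - 1 : ℕ)) atTop
      (𝓝 (1 - binaryEntropy δz)) := by
    rw [tendsto_iff_dist_tendsto_zero]
    have h3 : Tendsto (fun i : ℕ => (3 : ℝ) / (i + 8 : ℕ)) atTop (𝓝 0) :=
      (tendsto_const_div_atTop_nhds_zero_nat 3).comp (tendsto_add_atTop_nat 8)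
    refine squeeze_zero (fun _ => dist_nonneg) (fun i => ?_) h3
    have hsq' : ((i + 8 : ℕ) : ℝ) ^ 2 ≤ (2 ^ (i + 8) - 1 : ℕ) := by exact_mod_cast hsq i
    have hi : (0 : ℝ) < (i + 8 : ℕ) := by exact_mod_cast Nat.succ_pos _
    rw [Real.dist_eq, div_sub' (hnpos i).ne', abs_div, abs_of_pos (hnpos i),
      div_le_div_iff₀ (hnpos i) hi]
    refine (mul_le_mul_of_nonneg_right (hka i) hi.le).trans ?_
    linarith
  -- With δ = r + 1 the condition δ < 2r is just r > 1.
  refine ⟨fun i => i + 8, fun i => 2 ^ (i + 8) - 1, r, fun i => r i + 1, k, dz, α, y, fun i => ?_,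
    hn, ?_, ?_, hrate, hrate.limsup_eq⟩
  · have h1 := hr i
    have h2 := hr2 i
    beta_reduce
    exact ⟨rfl, by lia, h1, by lia, by lia, by lia, h2, hα i, hy i, hcss i, hk i, hdz i⟩
  · exact (tendsto_const_div_atTop_nhds_zero_nat 2).comp hn
  -- A real `liminf` needs a boundedness condition to be meaningful; dz ≤ n supplies it.
  · refine le_liminf_of_le (Filter.IsBoundedUnder.isCoboundedUnder_ge ⟨1, ?_⟩)
      (Eventually.of_forall fun i => ?_)
    · refine eventually_map.2 (Eventually.of_forall fun i => ?_)
      exact (div_le_one (hnpos i)).2 (by exact_mod_cast hdu i)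
    · exact (le_div_iff₀ (hnpos i)).2 (hdl i)
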